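/- Let $(\Omega,\mathcal F,\mathbb P)$ be a probability space and $\mathcal G\subseteq\mathcal F$ a sub-$\sigma$-algebra; (in)equalities between random variables are $\mathbb P$-a.s., and $\operatorname{ess\,sup}$, $\operatorname{ess\,inf}$ are the $\mathbb P$-essential supremum and infimum, with values in the extended real random variables. Let $L_{\mathcal F}\subseteq L^0(\Omega,\mathcal F,\mathbb P)$ and $L_{\mathcal G}\subseteq L^0(\Omega,\mathcal G,\mathbb P)$ be vector spaces that are lattices for the a.s. order, with $X\mathbf 1_A\in L_{\mathcal F}$ for $X\in L_{\mathcal F}$, $A\in\mathcal F$ and $Y\mathbf 1_A\in L_{\mathcal G}$ for $Y\in L_{\mathcal G}$, $A\in\mathcal G$. Let $L_{\mathcal F}^*$ be the order continuous dual of $L_{\mathcal F}$. Assume that every order continuous functional is of the form $\xi\mapsto E_{\mathbb P}[g\xi]$ with $g\in L^1(\Omega,\mathcal F,\mathbb P)$ (so that $L_{\mathcal F}^*$ is regarded as a subset of $L^1$), that $g\mathbf 1_A\in L^*_{\mathcal F}$ for $g\in L_{\mathcal F}^*$ and $A\in\mathcal F$, and that $L_{\mathcal F}^*$ separates the points of $L_{\mathcal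 F}$. Assume moreover that $L_{\mathcal G}\subseteq L_{\mathcal F}$ and that $L_{\mathcal G}$ contains the constants. Write $Q\in L_{\mathcal F}^*\cap\mathcal P$ if $Q\ll\mathbb P$ is a probability measure with $\frac{dQ}{d\mathbb P}\in L_{\mathcal F}^*$, and $Q\in L_{\mathcal F}^*\cap\mathcal P_{\mathcal G}$ if in addition $Q=\mathbb P$ on $\mathcal G$. Suppose that $E_Q[\xi|\mathcal G]\in L_{\mathcal F}$ for every $Q\in L_{\mathcal F}^*\cap\mathcal P_{\mathcal G}$ and $\xi\in L_{\mathcal F}$. Let $\pi:L_{\mathcal F}\to L_{\mathcal G}$ be * monotone: $X\le Y\Rightarrow\pi(X)\le\pi(Y)$; * regular: $\pi(X\mathbf 1_A+Y\mathbf 1_{A^c})=\pi(X)\mathbf 1_A+\pi(Y)\mathbf 1_{A^c}$ for $X,Y\in L_{\mathcal F}$, $A\in\mathcal G$; * cash additive: $\pi(X+\Lambda)=\pi(X)+\Lambda$ for $X\in L_{\mathcal F}$, $\Lambda\in L_{\mathcal G}$. For $X\in L_{\mathcal F}$ put $$K(X,Q)=\operatorname*{ess\,inf}_{\xi\in L_{\mathcal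 F}}\{\pi(\xi)\mid E_Q[\xi|\mathcal G]\ge E_Q[X|\mathcal G]\ Q\text{-a.s.}\},\qquad \pi^*(Q)=\operatorname*{ess\,sup}_{\xi\in L_{\mathcal F}}\{E_Q[\xi|\mathcal G]-\pi(\xi)\}.$$ (i) For every $Q\in L_{\mathcal F}^*\cap\mathcal P_{\mathcal G}$ and $X\in L_{\mathcal F}$, $$K(X,Q)=E_Q[X|\mathcal G]-\pi^*(Q).$$ (ii) Suppose in addition that $\pi$ is quasiconvex, i.e. $\pi(\Lambda X+(1-\Lambda)Y)\le\pi(X)\vee\pi(Y)$ for all $X,Y\in L_{\mathcal F}$ and $\mathcal G$-measurable $0\le\Lambda\le1$ (with $\Lambda X+(1-\Lambda)Y\in L_{\mathcal F}$), that $\pi$ is $\sigma(L_{\mathcal F},L_{\mathcal F}^*)$-lower semicontinuous, i.e. $\{X\in L_{\mathcal F}\mid\pi(X)\le Y\}$ is $\sigma(L_{\mathcal F},L_{\mathcal F}^*)$-closed for every $Y\in L_{\mathcal G}$, and that $L_{\mathcal F}^*\cap\mathcal P_{\mathcal G}\neq\emptyset$. Then, for every $X\in L_{\mathcal F}$, $$\pi(X)=\operatorname*{ess\,sup}_{Q\in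 L_{\mathcal F}^*\cap\mathcal P_{\mathcal G}}\{E_Q[X|\mathcal G]-\pi^*(Q)\}.$$ -/

import Mathlib

open MeasureTheory Filter Topology
open scoped ENNReal

universe u

namespace CondQuasiconvex

/-! ## Essential suprema and infima of families of extended real random variables

Extended real random variables are taken modulo `P`-a.e. equality, ordered `P`-a.e.; the essential
supremum (infimum) of a family is its least upper (greatest lower) bound for this order. -/

section Essential

variable {Ω : Type u} {mF : MeasurableSpace Ω} {P : Measure Ω}

/-- A bounded strictly increasing scale on the extended reals. -/
noncomputable def scale (x : EReal) : ℝ≥0∞ :=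
  (ENNReal.orderIsoIicOneBirational (EReal.expOrderIso x) : ℝ≥0∞)

theorem scale_strictMono : StrictMono scale := fun _ _ h =>
  ENNReal.orderIsoIicOneBirational.strictMono (EReal.expOrderIso.strictMono h)

theorem scale_le_one (x : EReal) : scale x ≤ 1 :=
  (ENNReal.orderIsoIicOneBirational (EReal.expOrderIso x)).2

/-- The pointwise supremum of a sequence of extended real random variables. -/
noncomputable def seqSup (s : ℕ → Ω →ₘ[P] EReal) : Ω →ₘ[P] EReal :=
  AEEqFun.mk (fun ω => ⨆ n, s n ω)
    (Measurable.iSup fun n => (s n).measurable).aestronglyMeasurable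

theorem coeFn_seqSup (s : ℕ → Ω →ₘ[P] EReal) : seqSup s =ᵐ[P] fun ω => ⨆ n, s n ω :=
  AEEqFun.coeFn_mk _ _

theorem le_seqSup (s : ℕ → Ω →ₘ[P] EReal) (n : ℕ) : s n ≤ seqSup s := by
  rw [← AEEqFun.coeFn_le]
  filter_upwards [coeFn_seqSup s] with ω h
  rw [h]
  exact le_iSup (fun n => s n ω) n

theorem seqSup_le (s : ℕ → Ω →ₘ[P] EReal) (W : Ω →ₘ[P] EReal) (h : ∀ n, s n ≤ W) :
    seqSup s ≤ W := by
  rw [← AEEqFun.coeFn_le]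
  have h' : ∀ᵐ ω ∂P, ∀ n, s n ω ≤ W ω :=
    ae_all_iff.2 fun n => AEEqFun.coeFn_le.2 (h n)
  filter_upwards [coeFn_seqSup s, h'] with ω h1 h2
  rw [h1]
  exact iSup_le h2

theorem exists_isLUB [IsFiniteMeasure P] (S : Set (Ω →ₘ[P] EReal)) : ∃ Z, IsLUB S Z := by
  rcases S.eq_empty_or_nonempty with rfl | hS
  · refine ⟨AEEqFun.const Ω ⊥, by simp, fun W _ => ?_⟩
    rw [← AEEqFun.coeFn_le]
    filter_upwards [AEEqFun.coeFn_const Ω (⊥ : EReal) (μ := P)] with ω h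
    rw [h]
    exact bot_le
  let J : (Ω →ₘ[P] EReal) → ℝ≥0∞ := fun Z => ∫⁻ ω, scale (Z ω) ∂P
  have hJ : Monotone J := fun Z W h => lintegral_mono_ae <| by
    filter_upwards [AEEqFun.coeFn_le.2 h] with ω hω using scale_strictMono.monotone hω
  have hJfin : ∀ Z, J Z ≠ ∞ := fun Z => ne_of_lt <|
    lt_of_le_of_lt (lintegral_mono fun ω => scale_le_one (Z ω)) (by simp)
  let T : Set ℝ≥0∞ := {c | ∃ s : ℕ → Ω →ₘ[P] EReal, (∀ n, s n ∈ S) ∧ c = J (seqSup s)}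
  have hT : T.Nonempty := by
    obtain ⟨f, hf⟩ := hS
    exact ⟨_, fun _ => f, fun _ => hf, rfl⟩
  obtain ⟨c, -, hc, hcT⟩ := exists_seq_tendsto_sSup hT (OrderTop.bddAbove T)
  choose t ht hct using hcT
  let s : ℕ → Ω →ₘ[P] EReal := fun n => t n.unpair.1 n.unpair.2
  have hs : ∀ n, s n ∈ S := fun n => ht _ _
  have hts : ∀ k, seqSup (t k) ≤ seqSup s := fun k => seqSup_le _ _ fun n => by
    have := le_seqSup s (Nat.pair k n)
    simpa [s] using this
  have hsup : sSup T ≤ J (seqSup s) :=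
    le_of_tendsto' hc fun k => by rw [hct]; exact hJ (hts k)
  refine ⟨seqSup s, fun f hf => ?_, fun W hW => seqSup_le _ _ fun n => hW (hs n)⟩
  let s' : ℕ → Ω →ₘ[P] EReal := fun n => Nat.casesOn n f s
  have hs' : ∀ n, s' n ∈ S := fun n => by cases n with
    | zero => exact hf
    | succ k => exact hs k
  have hle : seqSup s ≤ seqSup s' := seqSup_le _ _ fun n => le_seqSup s' (n + 1)
  have hJle : J (seqSup s') ≤ J (seqSup s) := le_trans (le_sSup (show J (seqSup s') ∈ T from ⟨s', hs', rfl⟩)) hsup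
  have hae : (fun ω => scale (seqSup s ω)) =ᵐ[P] fun ω => scale (seqSup s' ω) :=
    ae_eq_of_ae_le_of_lintegral_le
      (by filter_upwards [AEEqFun.coeFn_le.2 hle] with ω h using scale_strictMono.monotone h)
      (hJfin _) (scale_strictMono.monotone.measurable.comp (seqSup s').measurable).aemeasurable
      hJle
  refine le_trans (le_seqSup s' 0) ?_
  rw [← AEEqFun.coeFn_le]
  filter_upwards [hae] with ω h
  exact (scale_strictMono.injective h).ge

/-- The essential supremum of a family of extended real random variables. -/
noncomputable def aeSup [IsFiniteMeasure P] (S : Set (Ω →ₘ[P] EReal)) : Ω →ₘ[P] EReal :=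
  (exists_isLUB S).choose

theorem isLUB_aeSup [IsFiniteMeasure P] (S : Set (Ω →ₘ[P] EReal)) : IsLUB S (aeSup S) :=
  (exists_isLUB S).choose_spec

/-- The essential infimum of a family of extended real random variables. -/
noncomputable def aeInf [IsFiniteMeasure P] (S : Set (Ω →ₘ[P] EReal)) : Ω →ₘ[P] EReal :=
  aeSup (lowerBounds S)

theorem isGLB_aeInf [IsFiniteMeasure P] (S : Set (Ω →ₘ[P] EReal)) : IsGLB S (aeInf S) :=
  isLUB_lowerBounds.1 (isLUB_aeSup (lowerBounds S))

/-- A finite random variable regarded as an extended real one. -/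
noncomputable def toExt (X : Ω →ₘ[P] ℝ) : Ω →ₘ[P] EReal :=
  AEEqFun.comp Real.toEReal continuous_coe_real_ereal X

theorem continuous_coe_sub : Continuous (Function.uncurry fun (x : ℝ) (y : EReal) => (x : EReal) - y) := by
  rw [continuous_iff_continuousAt]
  rintro ⟨x, y⟩
  have h : ContinuousAt (fun p : EReal × EReal => p.1 + p.2) ((x : EReal), -y) :=
    EReal.continuousAt_add (Or.inl (EReal.coe_ne_top x)) (Or.inl (EReal.coe_ne_bot x))
  have h2 : Continuous fun p : ℝ × EReal => ((p.1 : EReal), -p.2) :=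
    (continuous_coe_real_ereal.comp continuous_fst).prodMk (continuous_neg.comp continuous_snd)
  exact ContinuousAt.comp (x := (x, y)) h h2.continuousAt

/-- `X - Z` for a finite random variable `X` and an extended real random variable `Z`. -/
noncomputable def extSub (X : Ω →ₘ[P] ℝ) (Z : Ω →ₘ[P] EReal) : Ω →ₘ[P] EReal :=
  AEEqFun.comp₂ (fun (x : ℝ) (y : EReal) => (x : EReal) - y) continuous_coe_sub X Z

end Essential

/-! ## Order continuous dual -/

section OrderDual

/-- The net `x` order converges to `0`: `|x i| ≤ y i` for some net `y` decreasing to `0`. -/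
def OrderTendstoZero {E : Type u} [AddCommGroup E] [PartialOrder E] {ι : Type u} [Preorder ι]
    (x : ι → E) : Prop :=
  ∃ y : ι → E, Antitone y ∧ IsGLB (Set.range y) 0 ∧ ∀ i, -(y i) ≤ x i ∧ x i ≤ y i

/-- Order continuous linear functionals: order null nets are mapped to null nets. -/
def IsOrderContinuous {E : Type u} [AddCommGroup E] [PartialOrder E] [Module ℝ E]
    (φ : E →ₗ[ℝ] ℝ) : Prop :=
  ∀ (ι : Type u) [Preorder ι] [IsDirectedOrder ι] [Nonempty ι] (x : ι → E),
    OrderTendstoZero x → Tendsto (fun i => φ (x i)) atTop (𝓝 0)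

variable {Ω : Type u} {mF : MeasurableSpace Ω} {P : Measure Ω}

/-- `g ∈ L¹(P)` represents the functional `φ` on `L`: `φ(ξ) = E_P[g ξ]` for all `ξ ∈ L`. -/
def Represents (L : Submodule ℝ (Ω →ₘ[P] ℝ)) (g : Ω →ₘ[P] ℝ) (φ : L →ₗ[ℝ] ℝ) : Prop :=
  Integrable g P ∧ ∀ ξ : L, Integrable (fun ω => g ω * (ξ : Ω →ₘ[P] ℝ) ω) P ∧
    φ ξ = ∫ ω, g ω * (ξ : Ω →ₘ[P] ℝ) ω ∂P

/-- The order continuous dual of `L`, as a set of `P`-integrable densities. -/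
def orderDual (L : Submodule ℝ (Ω →ₘ[P] ℝ)) : Set (Ω →ₘ[P] ℝ) :=
  {g | ∃ φ : L →ₗ[ℝ] ℝ, IsOrderContinuous φ ∧ Represents L g φ}

/-- The weak topology `σ(L, L*)` on `L`. -/
@[reducible] noncomputable def weakTopology (L : Submodule ℝ (Ω →ₘ[P] ℝ)) : TopologicalSpace L :=
  TopologicalSpace.induced
    (fun (ξ : L) (g : orderDual L) => ∫ ω, (g : Ω →ₘ[P] ℝ) ω * (ξ : Ω →ₘ[P] ℝ) ω ∂P)
    Pi.topologicalSpace

end OrderDual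

/-! ## The spaces, the probabilities and the maps -/

section Setting

variable {Ω : Type u} {mG mF : MeasurableSpace Ω} {P : Measure Ω}

/-- The (class of the) indicator function of a measurable set. -/
noncomputable def ind (P : Measure Ω) {A : Set Ω} (hA : MeasurableSet A) : Ω →ₘ[P] ℝ :=
  AEEqFun.mk (A.indicator fun _ => (1 : ℝ))
    (measurable_const.indicator hA).aestronglyMeasurable

/-- The assumptions on the spaces `L_F = LF` and `L_G = LG`. -/
structure Admissible (hm : mG ≤ mF) (LF LG : Submodule ℝ (Ω →ₘ[P] ℝ)) : Prop where
  /-- `L_F` and `L_G` are lattices for the `P`-a.s. order. -/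
  sup_memF : ∀ X ∈ LF, ∀ Y ∈ LF, X ⊔ Y ∈ LF
  inf_memF : ∀ X ∈ LF, ∀ Y ∈ LF, X ⊓ Y ∈ LF
  sup_memG : ∀ X ∈ LG, ∀ Y ∈ LG, X ⊔ Y ∈ LG
  inf_memG : ∀ X ∈ LG, ∀ Y ∈ LG, X ⊓ Y ∈ LG
  /-- The elements of `L_G` are `G`-measurable. -/
  measurableG : ∀ Y ∈ LG, AEStronglyMeasurable[mG] Y P
  /-- `L_F` and `L_G` are stable under multiplication by indicators of events of `F`, resp. `G`. -/
  ind_memF : ∀ X ∈ LF, ∀ (A : Set Ω) (hA : MeasurableSet[mF] A), X * ind P hA ∈ LF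
  ind_memG : ∀ Y ∈ LG, ∀ (A : Set Ω) (hA : MeasurableSet[mG] A), Y * ind P (hm A hA) ∈ LG
  /-- The order continuous dual of `L_F` is contained in `L¹(P)`... -/
  dual_repr : ∀ φ : LF →ₗ[ℝ] ℝ, IsOrderContinuous φ → ∃ g, Represents LF g φ
  /-- ... and stable under multiplication by indicators of events of `F`. -/
  ind_memDual : ∀ g ∈ orderDual LF, ∀ (A : Set Ω) (hA : MeasurableSet[mF] A),
    g * ind P hA ∈ orderDual LF
  /-- The order continuous dual separates the points of `L_F`, that is, `σ(L_F, L_F*)` is a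
  (Hausdorff) locally convex topology. -/
  separates : ∀ ξ ∈ LF, (∀ g ∈ orderDual LF, ∫ ω, g ω * ξ ω ∂P = 0) → ξ = 0

/-- The density `dQ/dP`. -/
noncomputable def density (P Q : Measure Ω) : Ω →ₘ[P] ℝ :=
  AEEqFun.mk (fun ω => (Q.rnDeriv P ω).toReal)
    (Measure.measurable_rnDeriv Q P).ennreal_toReal.aestronglyMeasurable

/-- The probabilities `Q ≪ P` with `dQ/dP ∈ L*`. -/
def dualProb (L : Submodule ℝ (Ω →ₘ[P] ℝ)) : Set (Measure Ω) :=
  {Q | IsProbabilityMeasure Q ∧ Q ≪ P ∧ density P Q ∈ orderDual L}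

/-- The probabilities `Q ≪ P` with `Q = P` on `G`. -/
def probAgreeing (mG : MeasurableSpace Ω) {mF : MeasurableSpace Ω} (P : Measure Ω) :
    Set (Measure Ω) :=
  {Q | IsProbabilityMeasure Q ∧ Q ≪ P ∧ ∀ A : Set Ω, MeasurableSet[mG] A → Q A = P A}

/-- The conditional expectation `E_Q[X | G]` as a class modulo `P` (used for `Q = P` on `G`, where
it is determined `P`-a.s.). -/
noncomputable def condE (hm : mG ≤ mF) (Q : Measure Ω) (X : Ω →ₘ[P] ℝ) : Ω →ₘ[P] ℝ :=
  AEEqFun.mk (condExp mG Q X) (stronglyMeasurable_condExp.mono hm).aestronglyMeasurable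

variable {LF LG : Submodule ℝ (Ω →ₘ[P] ℝ)}

/-- (QCO), for those conditional convex combinations that lie in the domain. -/
def IsQuasiconvex (mG : MeasurableSpace Ω) {mF : MeasurableSpace Ω} {P : Measure Ω}
    {LF LG : Submodule ℝ (Ω →ₘ[P] ℝ)} (π : LF → LG) : Prop :=
  ∀ (X Y Z : LF) (Λ : Ω →ₘ[P] ℝ), AEStronglyMeasurable[mG] Λ P → 0 ≤ Λ → Λ ≤ 1 →
    (Z : Ω →ₘ[P] ℝ) = Λ * (X : Ω →ₘ[P] ℝ) + (1 - Λ) * (Y : Ω →ₘ[P] ℝ) →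
    (π Z : Ω →ₘ[P] ℝ) ≤ (π X : Ω →ₘ[P] ℝ) ⊔ (π Y : Ω →ₘ[P] ℝ)

/-- (REG). -/
def IsRegularMap (hm : mG ≤ mF) (π : LF → LG) : Prop :=
  ∀ (X Y Z : LF) (A : Set Ω) (hA : MeasurableSet[mG] A),
    (Z : Ω →ₘ[P] ℝ) = (X : Ω →ₘ[P] ℝ) * ind P (hm A hA) + (Y : Ω →ₘ[P] ℝ) * ind P (hm A hA).compl →
    (π Z : Ω →ₘ[P] ℝ) =
      (π X : Ω →ₘ[P] ℝ) * ind P (hm A hA) + (π Y : Ω →ₘ[P] ℝ) * ind P (hm A hA).compl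

/-- (LSC) with respect to `σ(L_F, L_F*)`. -/
def IsWeakLSC (π : LF → LG) : Prop :=
  ∀ Y : LG, IsClosed[weakTopology LF] {X : LF | π X ≤ Y}

/-- (CAS). -/
def IsCashAdditive (π : LF → LG) : Prop :=
  ∀ (X Z : LF) (Λ : LG), (Z : Ω →ₘ[P] ℝ) = (X : Ω →ₘ[P] ℝ) + (Λ : Ω →ₘ[P] ℝ) →
    (π Z : Ω →ₘ[P] ℝ) = (π X : Ω →ₘ[P] ℝ) + (Λ : Ω →ₘ[P] ℝ)

/-- `K(X, Q) = ess inf {π(ξ) | ξ ∈ L_F, E_Q[ξ | G] ≥ E_Q[X | G] Q-a.s.}`. -/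
noncomputable def K (mG : MeasurableSpace Ω) {mF : MeasurableSpace Ω} {P : Measure Ω}
    [IsFiniteMeasure P] {LF LG : Submodule ℝ (Ω →ₘ[P] ℝ)} (π : LF → LG) (X : LF)
    (Q : Measure Ω) : Ω →ₘ[P] EReal :=
  aeInf {Z | ∃ ξ : LF, condExp mG Q (X : Ω →ₘ[P] ℝ) ≤ᵐ[Q] condExp mG Q (ξ : Ω →ₘ[P] ℝ) ∧
    Z = toExt (π ξ : Ω →ₘ[P] ℝ)}

/-- The conditional Fenchel conjugate `π*(Q) = ess sup {E_Q[ξ | G] - π(ξ) | ξ ∈ L_F}`. -/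
noncomputable def conjugate [IsFiniteMeasure P] (hm : mG ≤ mF) (π : LF → LG) (Q : Measure Ω) :
    Ω →ₘ[P] EReal :=
  aeSup {Z | ∃ ξ : LF, Z = toExt (condE hm Q (ξ : Ω →ₘ[P] ℝ) - (π ξ : Ω →ₘ[P] ℝ))}

end Setting

end CondQuasiconvex

/-! Fix `Q` and `ξ`. On the event where `E_Q[X|G] - E_Q[ξ|G] ≤ q`, with `q` rational, the shifted
position `ξ + q` competes in the infimum defining `K(X, Q)`, once it is replaced by `X` off the
event; letting `q` decrease to the difference gives `K(X, Q) ≤ E_Q[X|G] - (E_Q[ξ|G] - π(ξ))`.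

For the dual representation, let `B ∈ G` be non-null and separate `X - π(X) + ε 1_B` from the
acceptance set `{π ≤ 0}` by a density `g`, which is nonnegative because the acceptance set is a
lower set. As the acceptance set is stable under pasting along events of `G`, the strict
inequality between expectations holds between `G`-conditional expectations on some non-null event
`C ∈ G`, and normalizing `g` by `E[g|G]` on a part of `C` yields a probability `Q` agreeing with
`P` on `G`. All `ξ - π(ξ)` are accepted, so `Q` is `ε`-optimal there; by exhaustion such events
cover the space. -/

namespace CondQuasiconvex

section RandomVariables

variable {Ω : Type u} {mF : MeasurableSpace Ω} {P : Measure Ω}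

instance : IsOrderedAddMonoid (Ω →ₘ[P] ℝ) where
  add_le_add_left X Y hXY Z := by
    rw [← AEEqFun.coeFn_le] at hXY ⊢
    filter_upwards [hXY, AEEqFun.coeFn_add X Z, AEEqFun.coeFn_add Y Z] with ω h hX hY
    rw [hX, hY]
    exact add_le_add_left h _

theorem coeFn_smul_one (c : ℝ) : (c • (1 : Ω →ₘ[P] ℝ) : Ω →ₘ[P] ℝ) =ᵐ[P] fun _ => c := by
  filter_upwards [AEEqFun.coeFn_smul c (1 : Ω →ₘ[P] ℝ),
    AEEqFun.coeFn_one (α := Ω) (β := ℝ) (μ := P)] with ω hsmul hone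
  rw [hsmul, Pi.smul_apply, hone, Pi.one_apply, smul_eq_mul, mul_one]

theorem coeFn_ind {A : Set Ω} (hA : MeasurableSet A) :
    ind P hA =ᵐ[P] A.indicator fun _ => (1 : ℝ) :=
  AEEqFun.coeFn_mk _ _

theorem coeFn_mul_ind (X : Ω →ₘ[P] ℝ) {A : Set Ω} (hA : MeasurableSet A) :
    (X * ind P hA : Ω →ₘ[P] ℝ) =ᵐ[P] A.indicator X := by
  filter_upwards [AEEqFun.coeFn_mul X (ind P hA), coeFn_ind (P := P) hA] with ω hmul hind
  rw [hmul, Pi.mul_apply, hind]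
  by_cases hω : ω ∈ A <;> simp [hω]

open scoped Classical in
theorem coeFn_mul_ind_add_mul_ind_compl (X Y : Ω →ₘ[P] ℝ) {A : Set Ω} (hA : MeasurableSet A) :
    (X * ind P hA + Y * ind P hA.compl : Ω →ₘ[P] ℝ) =ᵐ[P] A.piecewise X Y := by
  filter_upwards [AEEqFun.coeFn_add (X * ind P hA) (Y * ind P hA.compl), coeFn_mul_ind X hA,
    coeFn_mul_ind Y hA.compl] with ω hadd hX hY
  rw [hadd, Pi.add_apply, hX, hY, ← Pi.add_apply, Set.indicator_add_compl_eq_piecewise]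

theorem coeFn_toExt (X : Ω →ₘ[P] ℝ) : toExt X =ᵐ[P] fun ω => (X ω : EReal) :=
  AEEqFun.coeFn_comp _ _ _

theorem coeFn_extSub (X : Ω →ₘ[P] ℝ) (Z : Ω →ₘ[P] EReal) :
    extSub X Z =ᵐ[P] fun ω => (X ω : EReal) - Z ω :=
  AEEqFun.coeFn_comp₂ _ _ _ _

theorem toExt_mono : Monotone (toExt : (Ω →ₘ[P] ℝ) → Ω →ₘ[P] EReal) := by
  intro X Y hXY
  rw [← AEEqFun.coeFn_le] at hXY ⊢
  filter_upwards [hXY, coeFn_toExt X, coeFn_toExt Y] with ω h hX hY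
  rw [hX, hY]
  exact EReal.coe_le_coe_iff.2 h

theorem extSub_toExt (X Y : Ω →ₘ[P] ℝ) : extSub X (toExt Y) = toExt (X - Y) := by
  refine AEEqFun.ext ?_
  filter_upwards [coeFn_extSub X (toExt Y), coeFn_toExt Y, coeFn_toExt (X - Y),
    AEEqFun.coeFn_sub X Y] with ω hext hY hXY hsub
  rw [hext, hY, hXY, hsub, Pi.sub_apply, EReal.coe_sub]

theorem extSub_anti (X : Ω →ₘ[P] ℝ) : Antitone (extSub X) := by
  intro Z W hZW
  rw [← AEEqFun.coeFn_le] at hZW ⊢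
  filter_upwards [hZW, coeFn_extSub X Z, coeFn_extSub X W] with ω h hZ hW
  rw [hZ, hW]
  exact EReal.sub_le_sub le_rfl h

theorem extSub_extSub (X : Ω →ₘ[P] ℝ) (Z : Ω →ₘ[P] EReal) : extSub X (extSub X Z) = Z := by
  refine AEEqFun.ext ?_
  filter_upwards [coeFn_extSub X (extSub X Z), coeFn_extSub X Z] with ω houter hinner
  rw [houter, hinner]
  induction Z ω with
  | bot => simp
  | top => simp
  | coe z => norm_cast; ring

theorem le_extSub_comm {X : Ω →ₘ[P] ℝ} {Z W : Ω →ₘ[P] EReal} :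
    Z ≤ extSub X W ↔ W ≤ extSub X Z :=
  ⟨fun h => (extSub_extSub X W).symm.le.trans (extSub_anti X h),
    fun h => (extSub_extSub X Z).symm.le.trans (extSub_anti X h)⟩

theorem extSub_le_comm {X : Ω →ₘ[P] ℝ} {Z W : Ω →ₘ[P] EReal} :
    extSub X Z ≤ W ↔ extSub X W ≤ Z :=
  ⟨fun h => (extSub_anti X h).trans (extSub_extSub X Z).le,
    fun h => (extSub_anti X h).trans (extSub_extSub X W).le⟩

open scoped Classical in
theorem aeSup_le_on [IsFiniteMeasure P] {S : Set (Ω →ₘ[P] EReal)} {W : Ω →ₘ[P] EReal} {C : Set Ω}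
    (hC : MeasurableSet C) (h : ∀ Z ∈ S, ∀ᵐ ω ∂P, ω ∈ C → Z ω ≤ W ω) :
    ∀ᵐ ω ∂P, ω ∈ C → aeSup S ω ≤ W ω := by
  let V : Ω →ₘ[P] EReal := AEEqFun.mk (C.piecewise W fun _ => ⊤)
    (W.measurable.piecewise hC measurable_const).aestronglyMeasurable
  have hV : V =ᵐ[P] C.piecewise W fun _ => ⊤ := AEEqFun.coeFn_mk _ _
  have hSV : aeSup S ≤ V := (isLUB_aeSup S).2 fun Z hZ => by
    rw [← AEEqFun.coeFn_le]
    filter_upwards [h Z hZ, hV] with ω hZW hVω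
    rw [hVω]
    by_cases hω : ω ∈ C <;> simp [hω, hZW]
  filter_upwards [AEEqFun.coeFn_le.2 hSV, hV] with ω hle hVω hω
  rwa [hVω, Set.piecewise_eq_of_mem _ _ _ hω] at hle

end RandomVariables

section ConditionalExpectation

variable {Ω : Type*} {m m₀ : MeasurableSpace Ω} {μ : Measure Ω}

open scoped Classical in
theorem condExp_piecewise {E : Type*} [NormedAddCommGroup E] [NormedSpace ℝ E] [CompleteSpace E]
    (hm : m ≤ m₀) {f g : Ω → E} (hf : Integrable f μ) (hg : Integrable g μ) {s : Set Ω}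
    (hs : MeasurableSet[m] s) : μ[s.piecewise f g | m] =ᵐ[μ] s.piecewise (μ[f | m]) (μ[g | m]) := by
  rw [← Set.indicator_add_compl_eq_piecewise, ← Set.indicator_add_compl_eq_piecewise]
  exact (condExp_add (hf.indicator (hm s hs)) (hg.indicator (hm s hs).compl) m).trans
    ((condExp_indicator hf hs).add (condExp_indicator hg hs.compl))

theorem ae_eq_zero_restrict_condExp_nonpos (hm : m ≤ m₀) [SigmaFinite (μ.trim hm)] {g : Ω → ℝ}
    (hg : Integrable g μ) (hg0 : 0 ≤ᵐ[μ] g) : g =ᵐ[μ.restrict {ω | (μ[g | m]) ω ≤ 0}] 0 := by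
  have hs : MeasurableSet[m] {ω | (μ[g | m]) ω ≤ 0} :=
    stronglyMeasurable_condExp.measurableSet_le stronglyMeasurable_const
  refine (setIntegral_eq_zero_iff_of_nonneg_ae (ae_restrict_of_ae hg0) hg.integrableOn).1
    (le_antisymm ?_ (integral_nonneg_of_ae (ae_restrict_of_ae hg0)))
  rw [← setIntegral_condExp hm hg hs]
  exact setIntegral_nonpos (hm _ hs) fun _ hω => hω

theorem ae_condExp_mul_eq_zero_of_condExp_nonpos (hm : m ≤ m₀) [SigmaFinite (μ.trim hm)]
    {g : Ω → ℝ} (hg : Integrable g μ) (hg0 : 0 ≤ᵐ[μ] g) (f : Ω → ℝ) :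
    ∀ᵐ ω ∂μ, (μ[g | m]) ω ≤ 0 → (μ[fun ω => g ω * f ω | m]) ω = 0 := by
  have hs : MeasurableSet[m] {ω | (μ[g | m]) ω ≤ 0} :=
    stronglyMeasurable_condExp.measurableSet_le stronglyMeasurable_const
  refine (ae_restrict_iff' (hm _ hs)).1 (condExp_ae_eq_restrict_zero hs ?_)
  filter_upwards [ae_eq_zero_restrict_condExp_nonpos hm hg hg0] with ω hω
  rw [hω, Pi.zero_apply, zero_mul]

end ConditionalExpectation

section Exhaustion

variable {Ω : Type*} {m m₀ : MeasurableSpace Ω} {μ : Measure Ω}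

theorem exists_monotone_exhausting [IsFiniteMeasure μ] {𝒜 : Set (Set Ω)}
    (hmeas : ∀ A ∈ 𝒜, MeasurableSet A) (hne : 𝒜.Nonempty)
    (hunion : ∀ A ∈ 𝒜, ∀ B ∈ 𝒜, A ∪ B ∈ 𝒜) :
    ∃ A : ℕ → Set Ω, Monotone A ∧ (∀ n, A n ∈ 𝒜) ∧ ∀ B ∈ 𝒜, B ≤ᵐ[μ] ⋃ n, A n := by
  obtain ⟨c, -, hc, hc𝒜⟩ := exists_seq_tendsto_sSup (hne.image μ) (OrderTop.bddAbove _)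
  choose t ht hct using hc𝒜
  have hacc : ∀ n, Set.accumulate t n ∈ 𝒜 := fun n => by
    induction n with
    | zero => simpa only [Set.accumulate_zero_nat] using ht 0
    | succ n ih =>
      rw [Set.accumulate_succ]
      exact hunion _ ih _ (ht _)
  refine ⟨Set.accumulate t, Set.monotone_accumulate, hacc, fun B hB => ?_⟩
  have hle : μ (B ∪ ⋃ n, Set.accumulate t n) ≤ μ (⋃ n, Set.accumulate t n) := by
    rw [Set.union_iUnion]
    refine (Monotone.measure_iUnion fun i j hij =>
      Set.union_subset_union_right B (Set.monotone_accumulate hij)).trans_le (iSup_le fun n => ?_)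
    refine (le_sSup (Set.mem_image_of_mem μ (hunion B hB _ (hacc n)))).trans ?_
    refine le_of_tendsto' hc fun k => ?_
    rw [← hct]
    exact measure_mono ((Set.subset_accumulate).trans (Set.subset_iUnion _ k))
  exact Set.subset_union_left.eventuallyLE.trans (ae_eq_of_ae_subset_of_measure_ge
    Set.subset_union_right.eventuallyLE hle
    (MeasurableSet.iUnion fun n => hmeas _ (hacc n)).nullMeasurableSet
    (measure_ne_top μ _)).symm.le

theorem ae_of_forall_exists_ae_on (hm : m ≤ m₀) [IsFiniteMeasure μ] {p : Ω → Prop}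
    (h : ∀ B, MeasurableSet[m] B → μ B ≠ 0 →
      ∃ C, MeasurableSet[m] C ∧ C ≤ᵐ[μ] B ∧ μ C ≠ 0 ∧ ∀ᵐ ω ∂μ, ω ∈ C → p ω) :
    ∀ᵐ ω ∂μ, p ω := by
  obtain ⟨A, -, hA, hexh⟩ := exists_monotone_exhausting (μ := μ)
    (𝒜 := {A | MeasurableSet[m] A ∧ ∀ᵐ ω ∂μ, ω ∈ A → p ω}) (fun A hA => hm A hA.1)
    ⟨∅, @MeasurableSet.empty _ m, by simp⟩
    (fun A hA B hB => ⟨hA.1.union hB.1, by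
      filter_upwards [hA.2, hB.2] with ω hpA hpB hω
      exact hω.elim hpA hpB⟩)
  have hU : MeasurableSet[m] (⋃ n, A n) := MeasurableSet.iUnion fun n => (hA n).1
  have hnull : μ (⋃ n, A n)ᶜ = 0 := by
    by_contra hpos
    obtain ⟨C, hC, hCU, hCpos, hpC⟩ := h _ hU.compl hpos
    refine hCpos (ae_eq_empty.1 ?_)
    filter_upwards [hCU, hexh C ⟨hC, hpC⟩] with ω hcompl hunion
    exact eq_false fun hω => hcompl hω (hunion hω)
  filter_upwards [compl_mem_ae_iff.2 hnull, ae_all_iff.2 fun n => (hA n).2] with ω hω hp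
  obtain ⟨n, hn⟩ := Set.mem_iUnion.1 (not_not.1 hω)
  exact hp n hn

/- Paste along an exhausting sequence of events on each of which some `f i` is nonnegative: if these
covered the space, then the integrals of the pasted functions would have a nonnegative limit. -/
open scoped Classical in
theorem exists_measurableSet_forall_ae_neg (hm : m ≤ m₀) [IsFiniteMeasure μ] {ι : Type*}
    [Nonempty ι] {f : ι → Ω → ℝ} (hf : ∀ i, StronglyMeasurable[m] (f i))
    (hint : ∀ i, Integrable (f i) μ)
    (hpaste : ∀ i j A, MeasurableSet[m] A → ∃ k, f k =ᵐ[μ] A.piecewise (f i) (f j))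
    {c : ℝ} (hc : c < 0) (hle : ∀ i, ∫ ω, f i ω ∂μ ≤ c) :
    ∃ C, MeasurableSet[m] C ∧ μ C ≠ 0 ∧ ∀ i, ∀ᵐ ω ∂μ, ω ∈ C → f i ω < 0 := by
  obtain ⟨i₀⟩ := ‹Nonempty ι›
  obtain ⟨A, hAmono, hA, hexh⟩ := exists_monotone_exhausting (μ := μ)
    (𝒜 := {A | MeasurableSet[m] A ∧ ∃ i, ∀ᵐ ω ∂μ, ω ∈ A → 0 ≤ f i ω}) (fun A hA => hm A hA.1)
    ⟨∅, @MeasurableSet.empty _ m, i₀, by simp⟩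
    (fun A ⟨hA, i, hi⟩ B ⟨hB, j, hj⟩ => by
      obtain ⟨k, hk⟩ := hpaste i j A hA
      refine ⟨hA.union hB, k, ?_⟩
      filter_upwards [hi, hj, hk] with ω hi hj hk hω
      rw [hk]
      by_cases hωA : ω ∈ A
      · simpa only [Set.piecewise_eq_of_mem _ _ _ hωA] using hi hωA
      · simpa only [Set.piecewise_eq_of_notMem _ _ _ hωA] using hj (hω.resolve_left hωA))
  have hU : MeasurableSet[m] (⋃ n, A n) := MeasurableSet.iUnion fun n => (hA n).1
  refine ⟨(⋃ n, A n)ᶜ, hU.compl, fun hnull => ?_, fun i => ?_⟩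
  · have hbound : ∀ n, ∫ ω in (A n)ᶜ, f i₀ ω ∂μ ≤ c := fun n => by
      obtain ⟨hAn, i, hi⟩ := hA n
      obtain ⟨k, hk⟩ := hpaste i i₀ (A n) hAn
      refine le_trans ?_ (hle k)
      rw [integral_congr_ae hk, integral_piecewise (hm _ hAn) (hint i).integrableOn
        (hint i₀).integrableOn]
      exact le_add_of_nonneg_left (setIntegral_nonneg_of_ae_restrict
        ((ae_restrict_iff' (hm _ hAn)).2 hi))
    have hlim := tendsto_setIntegral_of_antitone (fun n => (hm _ (hA n).1).compl)
      (fun i j hij => Set.compl_subset_compl.2 (hAmono hij)) ⟨0, (hint i₀).integrableOn⟩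
    rw [← Set.compl_iUnion, setIntegral_measure_zero _ hnull] at hlim
    exact hc.not_ge (le_of_tendsto' hlim hbound)
  · filter_upwards [hexh {ω | 0 ≤ f i ω} ⟨(hf i).measurable measurableSet_Ici, i, by simp⟩]
      with ω hω hωU
    exact not_le.1 fun h0 => hωU (hω h0)

theorem exists_pos_measure_inter_setOf_le_ne_zero {C : Set Ω} (hC : μ C ≠ 0) {f : Ω → ℝ}
    (hf : ∀ᵐ ω ∂μ, ω ∈ C → 0 < f ω) : ∃ δ > 0, μ (C ∩ {ω | δ ≤ f ω}) ≠ 0 := by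
  by_contra! hnull
  refine hC (measure_mono_null_ae (t := ⋃ n : ℕ, C ∩ {ω | 1 / ((n : ℝ) + 1) ≤ f ω}) ?_
    (measure_iUnion_null fun n => hnull _ Nat.one_div_pos_of_nat))
  filter_upwards [hf] with ω hpos hω
  obtain ⟨n, hn⟩ := exists_nat_one_div_lt (hpos hω)
  exact Set.mem_iUnion.2 ⟨n, hω, hn.le⟩

end Exhaustion

section OrderedSpaces

variable {E : Type u} [AddCommGroup E] [PartialOrder E]

theorem nonneg_of_bddAbove_image_lowerSet [IsOrderedAddMonoid E] (φ : E →+ ℝ) {C : Set E}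
    (hC : IsLowerSet C) (hne : C.Nonempty) (hφ : BddAbove (φ '' C)) {v : E} (hv : 0 ≤ v) :
    0 ≤ φ v := by
  obtain ⟨x, hx⟩ := hne
  obtain ⟨s, hs⟩ := hφ
  by_contra! hneg
  obtain ⟨n, hn⟩ := Archimedean.arch (s - φ x + 1) (neg_pos.2 hneg)
  have hle : φ (x - n • v) ≤ s :=
    hs (Set.mem_image_of_mem φ (hC (sub_le_self x (nsmul_nonneg hv n)) hx))
  rw [map_sub, map_nsmul] at hle
  rw [smul_neg] at hn
  linarith

variable [Module ℝ E]

theorem isOrderContinuous_zero : IsOrderContinuous (0 : E →ₗ[ℝ] ℝ) :=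
  fun _ _ _ _ _ _ => tendsto_const_nhds

theorem IsOrderContinuous.add {φ ψ : E →ₗ[ℝ] ℝ} (hφ : IsOrderContinuous φ)
    (hψ : IsOrderContinuous ψ) : IsOrderContinuous (φ + ψ) := fun ι _ _ _ x hx => by
  simpa only [LinearMap.add_apply, add_zero] using (hφ ι x hx).add (hψ ι x hx)

theorem IsOrderContinuous.smul {φ : E →ₗ[ℝ] ℝ} (hφ : IsOrderContinuous φ) (c : ℝ) :
    IsOrderContinuous (c • φ) := fun ι _ _ _ x hx => by
  simpa only [LinearMap.smul_apply, smul_zero] using (hφ ι x hx).const_smul c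

theorem IsOrderContinuous.of_abs_le [IsOrderedAddMonoid E] {φ ψ : E →ₗ[ℝ] ℝ}
    (hφ : IsOrderContinuous φ) (h : ∀ x y : E, -y ≤ x → x ≤ y → |ψ x| ≤ φ y) :
    IsOrderContinuous ψ := by
  rintro ι _ _ _ x ⟨y, hy, hglb, hxy⟩
  have hy0 : OrderTendstoZero y :=
    ⟨y, hy, hglb, fun i => ⟨neg_le_self (hglb.1 (Set.mem_range_self i)), le_rfl⟩⟩
  exact squeeze_zero_norm (fun i => h _ _ (hxy i).1 (hxy i).2) (hφ ι y hy0)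

end OrderedSpaces

section Duality

variable {Ω : Type u} {mF : MeasurableSpace Ω} {P : Measure Ω} {L : Submodule ℝ (Ω →ₘ[P] ℝ)}
  {g h : Ω →ₘ[P] ℝ} {φ ψ : L →ₗ[ℝ] ℝ}

theorem represents_zero : Represents L 0 0 := by
  have hzero : ∀ ξ : L, (fun ω => (0 : Ω →ₘ[P] ℝ) ω * (ξ : Ω →ₘ[P] ℝ) ω) =ᵐ[P] 0 := fun ξ => by
    filter_upwards [AEEqFun.coeFn_zero (α := Ω) (β := ℝ) (μ := P)] with ω hω
    rw [hω, Pi.zero_apply, zero_mul]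
  exact ⟨(integrable_zero Ω ℝ P).congr AEEqFun.coeFn_zero.symm, fun ξ =>
    ⟨(integrable_zero Ω ℝ P).congr (hzero ξ).symm, (integral_eq_zero_of_ae (hzero ξ)).symm⟩⟩

theorem Represents.add (hg : Represents L g φ) (hh : Represents L h ψ) :
    Represents L (g + h) (φ + ψ) := by
  have hadd : ∀ ξ : L, (fun ω => (g + h : Ω →ₘ[P] ℝ) ω * (ξ : Ω →ₘ[P] ℝ) ω) =ᵐ[P]
      fun ω => g ω * (ξ : Ω →ₘ[P] ℝ) ω + h ω * (ξ : Ω →ₘ[P] ℝ) ω := fun ξ => by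
    filter_upwards [AEEqFun.coeFn_add g h] with ω hω
    rw [hω, Pi.add_apply, add_mul]
  refine ⟨(hg.1.add hh.1).congr (AEEqFun.coeFn_add g h).symm, fun ξ =>
    ⟨((hg.2 ξ).1.add (hh.2 ξ).1).congr (hadd ξ).symm, ?_⟩⟩
  rw [integral_congr_ae (hadd ξ), integral_add (hg.2 ξ).1 (hh.2 ξ).1, ← (hg.2 ξ).2, ← (hh.2 ξ).2,
    LinearMap.add_apply]

theorem Represents.smul (hg : Represents L g φ) (c : ℝ) : Represents L (c • g) (c • φ) := by
  have hsmul : ∀ ξ : L, (fun ω => (c • g : Ω →ₘ[P] ℝ) ω * (ξ : Ω →ₘ[P] ℝ) ω) =ᵐ[P]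
      fun ω => c * (g ω * (ξ : Ω →ₘ[P] ℝ) ω) := fun ξ => by
    filter_upwards [AEEqFun.coeFn_smul c g] with ω hω
    rw [hω, Pi.smul_apply, smul_eq_mul, mul_assoc]
  refine ⟨(hg.1.smul c).congr (AEEqFun.coeFn_smul c g).symm, fun ξ =>
    ⟨((hg.2 ξ).1.const_mul c).congr (hsmul ξ).symm, ?_⟩⟩
  rw [integral_congr_ae (hsmul ξ), integral_const_mul, ← (hg.2 ξ).2, LinearMap.smul_apply,
    smul_eq_mul]

theorem integrable_of_mem_orderDual (hg : g ∈ orderDual L) : Integrable g P :=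
  let ⟨_, _, hrepr⟩ := hg
  hrepr.1

theorem integrable_mul_of_mem_orderDual (hg : g ∈ orderDual L) {ξ : Ω →ₘ[P] ℝ} (hξ : ξ ∈ L) :
    Integrable (fun ω => g ω * ξ ω) P :=
  let ⟨_, _, hrepr⟩ := hg
  (hrepr.2 ⟨ξ, hξ⟩).1

/-- The functional `ξ ↦ E_P[g ξ]` on `L`. -/
noncomputable def integralFunctional (L : Submodule ℝ (Ω →ₘ[P] ℝ)) (g : Ω →ₘ[P] ℝ)
    (hg : ∀ ξ ∈ L, Integrable (fun ω => g ω * ξ ω) P) : L →ₗ[ℝ] ℝ where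
  toFun ξ := ∫ ω, g ω * (ξ : Ω →ₘ[P] ℝ) ω ∂P
  map_add' ξ η := by
    rw [← integral_add (hg ξ ξ.2) (hg η η.2)]
    refine integral_congr_ae ?_
    filter_upwards [AEEqFun.coeFn_add (ξ : Ω →ₘ[P] ℝ) η] with ω hω
    rw [Submodule.coe_add, hω, Pi.add_apply, mul_add]
  map_smul' c ξ := by
    rw [RingHom.id_apply, smul_eq_mul, ← integral_const_mul]
    refine integral_congr_ae ?_
    filter_upwards [AEEqFun.coeFn_smul c (ξ : Ω →ₘ[P] ℝ)] with ω hω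
    rw [Submodule.coe_smul, hω, Pi.smul_apply, smul_eq_mul, mul_left_comm]

theorem mem_orderDual_of_abs_le (hg : g ∈ orderDual L) (hle : ∀ᵐ ω ∂P, |h ω| ≤ g ω) :
    h ∈ orderDual L := by
  obtain ⟨φ, hφ, hgi, hrepr⟩ := hg
  have hint : ∀ ξ ∈ L, Integrable (fun ω => h ω * ξ ω) P := fun ξ hξ => by
    refine (hrepr ⟨ξ, hξ⟩).1.mono (h.aestronglyMeasurable.mul ξ.aestronglyMeasurable) ?_
    filter_upwards [hle] with ω hω
    rw [norm_mul, norm_mul]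
    gcongr
    exact hω.trans (le_abs_self _)
  refine ⟨integralFunctional L h hint, hφ.of_abs_le fun ξ η hηξ hξη => ?_, hgi.mono
    h.aestronglyMeasurable (hle.mono fun ω hω => hω.trans (le_abs_self _)), fun ξ =>
    ⟨hint ξ ξ.2, rfl⟩⟩
  rw [(hrepr η).2, ← Real.norm_eq_abs]
  refine norm_integral_le_of_norm_le (hrepr η).1 ?_
  filter_upwards [hle, AEEqFun.coeFn_le.2 hηξ, AEEqFun.coeFn_le.2 hξη,
    AEEqFun.coeFn_neg (η : Ω →ₘ[P] ℝ)] with ω hh hlower hupper hneg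
  rw [Submodule.coe_neg, hneg, Pi.neg_apply] at hlower
  rw [norm_mul]
  exact mul_le_mul hh (abs_le.2 ⟨hlower, hupper⟩) (abs_nonneg _) ((abs_nonneg _).trans hh)

/-- The order continuous dual as a space of densities. -/
def orderDualSubmodule (L : Submodule ℝ (Ω →ₘ[P] ℝ)) : Submodule ℝ (Ω →ₘ[P] ℝ) where
  carrier := orderDual L
  add_mem' := fun ⟨φ, hφ, hg⟩ ⟨ψ, hψ, hh⟩ => ⟨φ + ψ, hφ.add hψ, hg.add hh⟩
  zero_mem' := ⟨0, isOrderContinuous_zero, represents_zero⟩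
  smul_mem' := fun c _ ⟨φ, hφ, hg⟩ => ⟨c • φ, hφ.smul c, hg.smul c⟩

/-- The duality `(ξ, g) ↦ E_P[g ξ]` between `L` and its order continuous dual, whose weak topology
is `σ(L, L*)`. -/
noncomputable def dualPairing (L : Submodule ℝ (Ω →ₘ[P] ℝ)) :
    L →ₗ[ℝ] orderDualSubmodule L →ₗ[ℝ] ℝ :=
  LinearMap.mk₂ ℝ (fun ξ g => ∫ ω, (g : Ω →ₘ[P] ℝ) ω * (ξ : Ω →ₘ[P] ℝ) ω ∂P)
    (fun ξ η g => by
      obtain ⟨φ, -, -, hφ⟩ := g.2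
      simp only [← (hφ _).2, map_add])
    (fun c ξ g => by
      obtain ⟨φ, -, -, hφ⟩ := g.2
      simp only [← (hφ _).2, map_smul])
    (fun ξ g h => by
      obtain ⟨φ, -, hφ⟩ := g.2
      obtain ⟨ψ, -, hψ⟩ := h.2
      rw [← (hφ.2 ξ).2, ← (hψ.2 ξ).2]
      exact ((hφ.add hψ).2 ξ).2.symm)
    (fun c ξ g => by
      obtain ⟨φ, -, hφ⟩ := g.2
      rw [← (hφ.2 ξ).2]
      exact ((hφ.smul c).2 ξ).2.symm)

theorem exists_separating_density {C : Set L} (hC : Convex ℝ C) (hcl : IsClosed[weakTopology L] C)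
    {x : L} (hx : x ∉ C) :
    ∃ g ∈ orderDual L, ∃ s : ℝ, (∀ ξ ∈ C, ∫ ω, g ω * (ξ : Ω →ₘ[P] ℝ) ω ∂P < s) ∧
      s < ∫ ω, g ω * (x : Ω →ₘ[P] ℝ) ω ∂P := by
  have hcl' : IsClosed (X := WeakBilin (dualPairing L)) C := hcl
  obtain ⟨f, s, hfC, hfx⟩ :=
    geometric_hahn_banach_closed_point (E := WeakBilin (dualPairing L)) hC hcl' hx
  obtain ⟨g, rfl⟩ := LinearMap.dualEmbedding_surjective (dualPairing L) f
  exact ⟨g, g.2, s, hfC, hfx⟩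

theorem ae_nonneg_of_bddAbove_on_lowerSet [IsFiniteMeasure P]
    (hg : g ∈ orderDual L) (hind : ∀ A (hA : MeasurableSet A), ind P hA ∈ L) {C : Set L}
    (hC : IsLowerSet C) (hne : C.Nonempty) {s : ℝ}
    (hs : ∀ ξ ∈ C, ∫ ω, g ω * (ξ : Ω →ₘ[P] ℝ) ω ∂P ≤ s) : 0 ≤ᵐ[P] g := by
  refine ae_nonneg_of_forall_setIntegral_nonneg (integrable_of_mem_orderDual hg) fun A hA _ => ?_
  let v : L := ⟨ind P hA, hind A hA⟩
  have hv : 0 ≤ v := by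
    refine AEEqFun.coeFn_le.1 ?_
    filter_upwards [AEEqFun.coeFn_zero (α := Ω) (β := ℝ) (μ := P), coeFn_ind (P := P) hA]
      with ω hzero hone
    rw [Submodule.coe_zero, hzero, hone]
    exact Set.indicator_nonneg (fun _ _ => zero_le_one) ω
  have hpos := nonneg_of_bddAbove_image_lowerSet (integralFunctional L g
    fun ξ hξ => integrable_mul_of_mem_orderDual hg hξ).toAddMonoidHom hC hne
    ⟨s, by rintro _ ⟨ξ, hξ, rfl⟩; exact hs ξ hξ⟩ hv
  refine hpos.trans_eq ((integral_congr_ae ?_).trans (integral_indicator hA))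
  filter_upwards [coeFn_ind (P := P) hA] with ω hone
  rw [hone]
  by_cases hω : ω ∈ A <;> simp [hω]

end Duality

section AgreeingProbabilities

variable {Ω : Type u} {mG mF : MeasurableSpace Ω} {P Q : Measure Ω}

theorem coeFn_density : density P Q =ᵐ[P] fun ω => (Q.rnDeriv P ω).toReal :=
  AEEqFun.coeFn_mk _ _

theorem coeFn_condE (hm : mG ≤ mF) (Q : Measure Ω) (X : Ω →ₘ[P] ℝ) :
    condE hm Q X =ᵐ[P] Q[X | mG] :=
  AEEqFun.coeFn_mk _ _

theorem trim_eq_trim_of_mem_probAgreeing (hm : mG ≤ mF) (hQ : Q ∈ probAgreeing mG P) :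
    Q.trim hm = P.trim hm := by
  refine @Measure.ext _ mG _ _ fun A hA => ?_
  rw [trim_measurableSet_eq hm hA, trim_measurableSet_eq hm hA, hQ.2.2 A hA]

theorem ae_le_of_mem_probAgreeing (hm : mG ≤ mF) (hQ : Q ∈ probAgreeing mG P) {f g : Ω → ℝ}
    (hf : StronglyMeasurable[mG] f) (hg : StronglyMeasurable[mG] g) (hfg : f ≤ᵐ[Q] g) :
    f ≤ᵐ[P] g := by
  have hle := hf.ae_le_trim_of_stronglyMeasurable hm hg hfg
  rw [trim_eq_trim_of_mem_probAgreeing hm hQ] at hle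
  exact ae_le_of_ae_le_trim hle

theorem ae_eq_of_mem_probAgreeing (hm : mG ≤ mF) (hQ : Q ∈ probAgreeing mG P) {f g : Ω → ℝ}
    (hf : StronglyMeasurable[mG] f) (hg : StronglyMeasurable[mG] g) (hfg : f =ᵐ[Q] g) :
    f =ᵐ[P] g :=
  (ae_le_of_mem_probAgreeing hm hQ hf hg hfg.le).antisymm
    (ae_le_of_mem_probAgreeing hm hQ hg hf hfg.symm.le)

theorem condE_le_condE (hm : mG ≤ mF) (hQ : Q ∈ probAgreeing mG P) {X Y : Ω →ₘ[P] ℝ}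
    (hXY : Q[X | mG] ≤ᵐ[Q] Q[Y | mG]) : condE hm Q X ≤ condE hm Q Y := by
  rw [← AEEqFun.coeFn_le]
  filter_upwards [ae_le_of_mem_probAgreeing hm hQ stronglyMeasurable_condExp
    stronglyMeasurable_condExp hXY, coeFn_condE hm Q X, coeFn_condE hm Q Y] with ω hle hX hY
  rwa [hX, hY]

theorem condE_add_of_aestronglyMeasurable (hm : mG ≤ mF) (hQ : Q ∈ probAgreeing mG P)
    {X Λ : Ω →ₘ[P] ℝ} (hX : Integrable X Q) (hΛ : Integrable Λ Q)
    (hΛm : AEStronglyMeasurable[mG] Λ P) : condE hm Q (X + Λ) = condE hm Q X + Λ := by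
  have := hQ.1
  have hadd : Q[(X + Λ : Ω →ₘ[P] ℝ) | mG] =ᵐ[Q] Q[X | mG] + hΛm.mk Λ := by
    refine (condExp_congr_ae (hQ.2.1.ae_eq (AEEqFun.coeFn_add X Λ))).trans
      ((condExp_add hX hΛ mG).trans ((EventuallyEq.refl _ _).add ?_))
    exact (condExp_of_aestronglyMeasurable' hm (hΛm.mono_ac hQ.2.1) hΛ).trans
      (hQ.2.1.ae_eq hΛm.ae_eq_mk)
  refine AEEqFun.ext ?_
  filter_upwards [coeFn_condE hm Q (X + Λ), coeFn_condE hm Q X, hΛm.ae_eq_mk,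
    AEEqFun.coeFn_add (condE hm Q X) Λ, ae_eq_of_mem_probAgreeing hm hQ stronglyMeasurable_condExp
      (stronglyMeasurable_condExp.add hΛm.stronglyMeasurable_mk) hadd] with ω hXΛ hX hmk hsum h
  rw [hXΛ, h, hsum, Pi.add_apply, Pi.add_apply, hX, ← hmk]

theorem condE_sub_of_aestronglyMeasurable (hm : mG ≤ mF) (hQ : Q ∈ probAgreeing mG P)
    {X Λ : Ω →ₘ[P] ℝ} (hX : Integrable X Q) (hΛ : Integrable Λ Q)
    (hΛm : AEStronglyMeasurable[mG] Λ P) : condE hm Q (X - Λ) = condE hm Q X - Λ := by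
  have hneg := AEEqFun.coeFn_neg Λ
  rw [sub_eq_add_neg, sub_eq_add_neg, condE_add_of_aestronglyMeasurable hm hQ hX
    (hΛ.neg.congr (hQ.2.1.ae_eq hneg.symm)) (hΛm.neg.congr hneg.symm)]

variable [IsFiniteMeasure P]

theorem integrable_density_mul_iff [SigmaFinite Q] (hQP : Q ≪ P) {f : Ω → ℝ} :
    Integrable (fun ω => density P Q ω * f ω) P ↔ Integrable f Q := by
  rw [← integrable_toReal_rnDeriv_mul_iff hQP]
  refine integrable_congr ?_
  filter_upwards [coeFn_density (P := P) (Q := Q)] with ω hω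
  rw [hω]

theorem integrable_of_mem_dualProb {L : Submodule ℝ (Ω →ₘ[P] ℝ)} (hQ : Q ∈ dualProb L)
    {ξ : Ω →ₘ[P] ℝ} (hξ : ξ ∈ L) : Integrable ξ Q :=
  have := hQ.1
  (integrable_density_mul_iff hQ.2.1).1 (integrable_mul_of_mem_orderDual hQ.2.2 hξ)

theorem condExp_ae_eq_condExp_density_mul (hm : mG ≤ mF) (hQ : Q ∈ probAgreeing mG P) {f : Ω → ℝ}
    (hf : Integrable f Q) : Q[f | mG] =ᵐ[P] P[fun ω => density P Q ω * f ω | mG] := by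
  have := hQ.1
  have htrim := trim_eq_trim_of_mem_probAgreeing hm hQ
  have hsm : StronglyMeasurable[mG] (Q[f | mG]) := stronglyMeasurable_condExp
  have hint : Integrable (Q[f | mG]) P := by
    refine integrable_of_integrable_trim hm ?_
    rw [← htrim]
    exact integrable_condExp.trim hm hsm
  refine ae_eq_condExp_of_forall_setIntegral_eq hm ((integrable_density_mul_iff hQ.2.1).2 hf)
    (fun _ _ _ => hint.integrableOn) (fun A hA _ => ?_) hsm.aestronglyMeasurable
  rw [setIntegral_trim hm hsm hA, ← htrim, ← setIntegral_trim hm hsm hA,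
    setIntegral_condExp hm hf hA, ← setIntegral_toReal_rnDeriv_mul hQ.2.1 (hm A hA)]
  refine setIntegral_congr_ae (hm A hA) ?_
  filter_upwards [coeFn_density (P := P) (Q := Q)] with ω hω _
  rw [hω]

theorem condExp_density (hm : mG ≤ mF) (hQ : Q ∈ probAgreeing mG P) :
    P[density P Q | mG] =ᵐ[P] fun _ => 1 := by
  have := hQ.1
  have hone := condExp_ae_eq_condExp_density_mul hm hQ (integrable_const (1 : ℝ))
  rw [condExp_const hm] at hone
  simpa only [mul_one] using hone.symm

end AgreeingProbabilities

section Normalization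

variable {Ω : Type u} {mG mF : MeasurableSpace Ω} {P : Measure Ω}
  {L : Submodule ℝ (Ω →ₘ[P] ℝ)}

theorem exists_mem_dualProb_density_eq [IsProbabilityMeasure P] (hm : mG ≤ mF) {h : Ω →ₘ[P] ℝ}
    (hh : h ∈ orderDual L) (hh0 : 0 ≤ᵐ[P] h) (hone : P[h | mG] =ᵐ[P] fun _ => 1) :
    ∃ Q ∈ dualProb L ∩ probAgreeing mG P, density P Q = h := by
  have hint := integrable_of_mem_orderDual hh
  let Q : Measure Ω := P.withDensity fun ω => ENNReal.ofReal (h ω)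
  have hagree : ∀ A, MeasurableSet[mG] A → Q A = P A := fun A hA => by
    rw [withDensity_apply _ (hm A hA), ← ofReal_integral_eq_lintegral_ofReal hint.integrableOn
      (ae_restrict_of_ae hh0), ← setIntegral_condExp hm hint hA,
      setIntegral_congr_ae (hm A hA) (hone.mono fun ω hω _ => hω), setIntegral_const, smul_eq_mul,
      mul_one, measureReal_def, ENNReal.ofReal_toReal (measure_ne_top P A)]
  have hprob : IsProbabilityMeasure Q :=
    ⟨(hagree _ (@MeasurableSet.univ _ mG)).trans measure_univ⟩
  have hdens : density P Q = h := by
    refine AEEqFun.ext ?_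
    filter_upwards [coeFn_density (P := P) (Q := Q), hh0,
      Measure.rnDeriv_withDensity P h.measurable.ennreal_ofReal] with ω hdens h0 hrn
    rw [hdens, hrn, ENNReal.toReal_ofReal h0]
  exact ⟨Q, ⟨⟨hprob, withDensity_absolutelyContinuous _ _, hdens.symm ▸ hh⟩, hprob,
    withDensity_absolutelyContinuous _ _, hagree⟩, hdens⟩

open scoped Classical in
theorem exists_mem_orderDual_condExp_mul_eq_piecewise (hm : mG ≤ mF) {g g₀ : Ω →ₘ[P] ℝ}
    (hg : g ∈ orderDual L) (hg₀ : g₀ ∈ orderDual L) (hg_nonneg : 0 ≤ᵐ[P] g)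
    (hg₀_nonneg : 0 ≤ᵐ[P] g₀) {C : Set Ω} (hC : MeasurableSet[mG] C) {δ : ℝ} (hδ : 0 < δ)
    (hCδ : ∀ ω ∈ C, δ ≤ (P[g | mG]) ω) :
    ∃ h ∈ orderDual L, 0 ≤ᵐ[P] h ∧ ∀ f : Ω → ℝ, Integrable (fun ω => g ω * f ω) P →
      Integrable (fun ω => g₀ ω * f ω) P → P[fun ω => h ω * f ω | mG] =ᵐ[P] C.piecewise
        (fun ω => ((P[g | mG]) ω)⁻¹ * (P[fun ω => g ω * f ω | mG]) ω)
        (P[fun ω => g₀ ω * f ω | mG]) := by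
  let u : Ω → ℝ := C.indicator fun ω => ((P[g | mG]) ω)⁻¹
  have hu : StronglyMeasurable[mG] u := stronglyMeasurable_condExp.inv₀.indicator hC
  have hu_nonneg : ∀ ω, 0 ≤ u ω :=
    Set.indicator_nonneg fun ω hω => inv_nonneg.2 (hδ.le.trans (hCδ ω hω))
  have hu_le : ∀ ω, u ω ≤ δ⁻¹ := fun ω =>
    Set.indicator_le' (fun ω hω => inv_anti₀ hδ (hCδ ω hω)) (fun _ _ => (inv_pos.2 hδ).le) ω
  let h : Ω →ₘ[P] ℝ := AEEqFun.mk (C.piecewise (fun ω => u ω * g ω) g₀)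
    (((hu.mono hm).measurable.mul g.measurable).piecewise (hm C hC)
      g₀.measurable).aestronglyMeasurable
  have hh : h =ᵐ[P] C.piecewise (fun ω => u ω * g ω) g₀ := AEEqFun.coeFn_mk _ _
  have hbounds : ∀ᵐ ω ∂P, 0 ≤ h ω ∧ h ω ≤ (δ⁻¹ • g + g₀ : Ω →ₘ[P] ℝ) ω := by
    filter_upwards [hh, hg_nonneg, hg₀_nonneg, AEEqFun.coeFn_add (δ⁻¹ • g) g₀,
      AEEqFun.coeFn_smul δ⁻¹ g] with ω hω hgω hg₀ω hadd hsmul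
    rw [hω, hadd, Pi.add_apply, hsmul, Pi.smul_apply, smul_eq_mul]
    have hug := mul_le_mul_of_nonneg_right (hu_le ω) hgω
    have hug0 := mul_nonneg (hu_nonneg ω) hgω
    rw [Pi.zero_apply] at hgω hg₀ω
    by_cases hωC : ω ∈ C
    · rw [Set.piecewise_eq_of_mem _ _ _ hωC]
      constructor <;> linarith
    · rw [Set.piecewise_eq_of_notMem _ _ _ hωC]
      constructor <;> linarith
  refine ⟨h, mem_orderDual_of_abs_le ((orderDualSubmodule L).add_mem
    ((orderDualSubmodule L).smul_mem δ⁻¹ hg) hg₀) (hbounds.mono fun ω hω => ?_),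
    hbounds.mono fun ω hω => hω.1, fun f hgf hg₀f => ?_⟩
  · rw [abs_of_nonneg hω.1]
    exact hω.2
  have hugf : Integrable (u * fun ω => g ω * f ω) P :=
    hgf.bdd_mul (hu.mono hm).aestronglyMeasurable (ae_of_all _ fun ω => by
      rw [Real.norm_of_nonneg (hu_nonneg ω)]
      exact hu_le ω)
  have hhf : (fun ω => h ω * f ω) =ᵐ[P]
      C.piecewise (u * fun ω => g ω * f ω) fun ω => g₀ ω * f ω := by
    filter_upwards [hh] with ω hω
    by_cases hωC : ω ∈ C <;> simp [hω, hωC, mul_assoc]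
  filter_upwards [condExp_congr_ae (m := mG) hhf, condExp_piecewise hm hugf hg₀f hC,
    condExp_mul_of_stronglyMeasurable_left hu hugf hgf] with ω hcongr hpiece hpull
  rw [hcongr, hpiece]
  by_cases hωC : ω ∈ C <;> simp [hωC, hpull, u]

theorem exists_mem_dualProb_condE_eq_on [IsProbabilityMeasure P] (hm : mG ≤ mF)
    (hne : (dualProb L ∩ probAgreeing mG P).Nonempty) {g : Ω →ₘ[P] ℝ} (hg : g ∈ orderDual L)
    (hg_nonneg : 0 ≤ᵐ[P] g) {C : Set Ω} (hC : MeasurableSet[mG] C) {δ : ℝ} (hδ : 0 < δ)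
    (hCδ : ∀ ω ∈ C, δ ≤ (P[g | mG]) ω) :
    ∃ Q ∈ dualProb L ∩ probAgreeing mG P, ∀ ξ ∈ L, ∀ᵐ ω ∂P, ω ∈ C →
      condE hm Q ξ ω = ((P[g | mG]) ω)⁻¹ * (P[fun ω => g ω * ξ ω | mG]) ω := by
  classical
  obtain ⟨Q₀, hQ₀, hQ₀_agree⟩ := hne
  have hg₀_nonneg : 0 ≤ᵐ[P] density P Q₀ :=
    coeFn_density.mono fun ω hω => hω.symm ▸ ENNReal.toReal_nonneg
  obtain ⟨h, hh, hh_nonneg, hcond⟩ := exists_mem_orderDual_condExp_mul_eq_piecewise hm hg hQ₀.2.2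
    hg_nonneg hg₀_nonneg hC hδ hCδ
  have hone : P[h | mG] =ᵐ[P] fun _ => 1 := by
    have h1 := hcond (fun _ => 1) (by simpa only [mul_one] using integrable_of_mem_orderDual hg)
      (by simpa only [mul_one] using integrable_of_mem_orderDual hQ₀.2.2)
    simp only [mul_one] at h1
    filter_upwards [h1, condExp_density hm hQ₀_agree] with ω hω hdens
    by_cases hωC : ω ∈ C
    · rw [hω, Set.piecewise_eq_of_mem _ _ _ hωC,
        inv_mul_cancel₀ (hδ.trans_le (hCδ ω hωC)).ne']
    · rw [hω, Set.piecewise_eq_of_notMem _ _ _ hωC, hdens]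
  obtain ⟨Q, hQ, hQh⟩ := exists_mem_dualProb_density_eq hm hh hh_nonneg hone
  refine ⟨Q, hQ, fun ξ hξ => ?_⟩
  filter_upwards [coeFn_condE hm Q ξ, condExp_ae_eq_condExp_density_mul hm hQ.2
    (integrable_of_mem_dualProb hQ.1 hξ), hcond ξ (integrable_mul_of_mem_orderDual hg hξ)
    (integrable_mul_of_mem_orderDual hQ₀.2.2 hξ)] with ω hE hbayes hpiece hωC
  rw [hE, hbayes, hQh, hpiece, Set.piecewise_eq_of_mem _ _ _ hωC]

end Normalization

section RegularMaps

variable {Ω : Type u} {mG mF : MeasurableSpace Ω} {P : Measure Ω}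

open scoped Classical in
/-- Stability of a set of random variables under pasting along events of `G`. -/
def IsPasteStable (mG : MeasurableSpace Ω) {_mF : MeasurableSpace Ω} {P : Measure Ω}
    {L : Submodule ℝ (Ω →ₘ[P] ℝ)} (C : Set L) : Prop :=
  ∀ ξ ∈ C, ∀ η ∈ C, ∀ A, MeasurableSet[mG] A →
    ∃ ζ ∈ C, (ζ : Ω →ₘ[P] ℝ) =ᵐ[P] A.piecewise (ξ : Ω →ₘ[P] ℝ) (η : Ω →ₘ[P] ℝ)

variable {LF LG : Submodule ℝ (Ω →ₘ[P] ℝ)} {π : LF → LG}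

/-- The positions that `π` accepts, that is, whose value under `π` is not positive. -/
def acceptanceSet (π : LF → LG) : Set LF :=
  {X | π X ≤ 0}

theorem isLowerSet_acceptanceSet (hmon : Monotone π) : IsLowerSet (acceptanceSet π) :=
  fun _ _ hYX hX => (hmon hYX).trans hX

theorem IsQuasiconvex.convex_acceptanceSet (hqco : IsQuasiconvex mG π) :
    Convex ℝ (acceptanceSet π) := by
  intro X hX Y hY a b ha hb hab
  have hzero := AEEqFun.coeFn_zero (α := Ω) (β := ℝ) (μ := P)
  have hone := AEEqFun.coeFn_one (α := Ω) (β := ℝ) (μ := P)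
  have hconst := coeFn_smul_one (P := P) a
  refine (hqco X Y (a • X + b • Y) (a • 1) (aestronglyMeasurable_const.congr hconst.symm)
    (AEEqFun.coeFn_le.1 ?_) (AEEqFun.coeFn_le.1 ?_) (AEEqFun.ext ?_)).trans (sup_le hX hY)
  · filter_upwards [hzero, hconst] with ω hω hconst
    rwa [hω, hconst]
  · filter_upwards [hone, hconst] with ω hω hconst
    rw [hω, hconst, Pi.one_apply]
    linarith
  · filter_upwards [hone, hconst, AEEqFun.coeFn_add (a • (X : Ω →ₘ[P] ℝ)) (b • (Y : Ω →ₘ[P] ℝ)),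
      AEEqFun.coeFn_smul a (X : Ω →ₘ[P] ℝ), AEEqFun.coeFn_smul b (Y : Ω →ₘ[P] ℝ),
      AEEqFun.coeFn_add (a • 1 * (X : Ω →ₘ[P] ℝ)) ((1 - a • 1) * (Y : Ω →ₘ[P] ℝ)),
      AEEqFun.coeFn_mul (a • 1) (X : Ω →ₘ[P] ℝ), AEEqFun.coeFn_mul (1 - a • 1) (Y : Ω →ₘ[P] ℝ),
      AEEqFun.coeFn_sub (1 : Ω →ₘ[P] ℝ) (a • 1)] with ω hone hconst hadd hX hY hadd' hX' hY' hsub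
    rw [Submodule.coe_add, Submodule.coe_smul, Submodule.coe_smul, hadd, hadd', Pi.add_apply,
      Pi.add_apply, hX, hY, hX', hY', Pi.mul_apply, Pi.mul_apply, hsub, Pi.sub_apply, hone, hconst,
      Pi.smul_apply, Pi.smul_apply, Pi.one_apply, smul_eq_mul, smul_eq_mul, eq_sub_of_add_eq' hab]

open scoped Classical in
theorem IsRegularMap.exists_piecewise {hm : mG ≤ mF} (hreg : IsRegularMap hm π)
    (hstab : ∀ X ∈ LF, ∀ A (hA : MeasurableSet A), X * ind P hA ∈ LF) (X Y : LF) {A : Set Ω}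
    (hA : MeasurableSet[mG] A) :
    ∃ Z : LF, (Z : Ω →ₘ[P] ℝ) =ᵐ[P] A.piecewise (X : Ω →ₘ[P] ℝ) (Y : Ω →ₘ[P] ℝ) ∧
      (π Z : Ω →ₘ[P] ℝ) =ᵐ[P] A.piecewise (π X : Ω →ₘ[P] ℝ) (π Y : Ω →ₘ[P] ℝ) := by
  let Z : LF := ⟨X * ind P (hm A hA) + Y * ind P (hm A hA).compl,
    LF.add_mem (hstab X X.2 A _) (hstab Y Y.2 Aᶜ _)⟩
  refine ⟨Z, coeFn_mul_ind_add_mul_ind_compl _ _ _, ?_⟩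
  rw [hreg X Y Z A hA rfl]
  exact coeFn_mul_ind_add_mul_ind_compl _ _ _

theorem IsRegularMap.isPasteStable_acceptanceSet {hm : mG ≤ mF} (hreg : IsRegularMap hm π)
    (hstab : ∀ X ∈ LF, ∀ A (hA : MeasurableSet A), X * ind P hA ∈ LF) :
    IsPasteStable mG (acceptanceSet π) := by
  classical
  intro X hX Y hY A hA
  obtain ⟨Z, hZ, hπZ⟩ := hreg.exists_piecewise hstab X Y hA
  refine ⟨Z, AEEqFun.coeFn_le.1 ?_, hZ⟩
  filter_upwards [hπZ, AEEqFun.coeFn_le.2 hX, AEEqFun.coeFn_le.2 hY] with ω hω hXω hYω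
  rw [hω]
  by_cases hωA : ω ∈ A
  · rwa [Set.piecewise_eq_of_mem _ _ _ hωA]
  · rwa [Set.piecewise_eq_of_notMem _ _ _ hωA]

theorem IsCashAdditive.map_add (hcas : IsCashAdditive π) (hGF : LG ≤ LF) (X : LF) (Λ : LG) :
    π (X + Submodule.inclusion hGF Λ) = π X + Λ :=
  Subtype.ext (hcas X _ Λ rfl)

theorem IsCashAdditive.map_sub_self (hcas : IsCashAdditive π) (hGF : LG ≤ LF) (X : LF) :
    π (X - Submodule.inclusion hGF (π X)) = 0 := by
  rw [sub_eq_add_neg, ← map_neg, hcas.map_add hGF, add_neg_cancel]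

/- By regularity and cash additivity, `π (1_B) - π 0 = 1_B`. -/
theorem IsRegularMap.ind_mem {hm : mG ≤ mF} (hreg : IsRegularMap hm π) (hcas : IsCashAdditive π)
    (hstab : ∀ X ∈ LF, ∀ A (hA : MeasurableSet A), X * ind P hA ∈ LF) (hGF : LG ≤ LF)
    (hone : (1 : Ω →ₘ[P] ℝ) ∈ LG) {B : Set Ω} (hB : MeasurableSet[mG] B) :
    ind P (hm B hB) ∈ LG := by
  classical
  obtain ⟨Z, -, hZ⟩ := hreg.exists_piecewise hstab (0 + Submodule.inclusion hGF ⟨1, hone⟩) 0 hB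
  have hdiff : ind P (hm B hB) = (π Z : Ω →ₘ[P] ℝ) - π 0 := by
    refine AEEqFun.ext ?_
    filter_upwards [coeFn_ind (P := P) (hm B hB), AEEqFun.coeFn_sub (π Z : Ω →ₘ[P] ℝ) (π 0),
      AEEqFun.coeFn_add (π 0 : Ω →ₘ[P] ℝ) 1, AEEqFun.coeFn_one (α := Ω) (β := ℝ) (μ := P), hZ]
      with ω hind hsub hadd hone' hZω
    rw [hcas.map_add hGF, Submodule.coe_add] at hZω
    rw [hind, hsub, Pi.sub_apply, hZω]
    by_cases hω : ω ∈ B <;> simp [hω, hadd, hone']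
  rw [hdiff]
  exact LG.sub_mem (π Z).2 (π 0).2

end RegularMaps

section PenaltyFunction

variable {Ω : Type u} {mG mF : MeasurableSpace Ω} {P Q : Measure Ω} [IsFiniteMeasure P]
  {LF LG : Submodule ℝ (Ω →ₘ[P] ℝ)} {π : LF → LG}

theorem toExt_le_conjugate (hm : mG ≤ mF) (π : LF → LG) (Q : Measure Ω) (ξ : LF) :
    toExt (condE hm Q (ξ : Ω →ₘ[P] ℝ) - (π ξ : Ω →ₘ[P] ℝ)) ≤ conjugate hm π Q :=
  (isLUB_aeSup _).1 ⟨ξ, rfl⟩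

theorem conjugate_le_iff {hm : mG ≤ mF} {W : Ω →ₘ[P] EReal} :
    conjugate hm π Q ≤ W ↔
      ∀ ξ : LF, toExt (condE hm Q (ξ : Ω →ₘ[P] ℝ) - (π ξ : Ω →ₘ[P] ℝ)) ≤ W :=
  (isLUB_le_iff (isLUB_aeSup _)).trans ⟨fun h ξ => h ⟨ξ, rfl⟩, fun h _ ⟨ξ, hξ⟩ => hξ ▸ h ξ⟩

theorem extSub_conjugate_le_toExt (hm : mG ≤ mF) (π : LF → LG) (Q : Measure Ω) (X : LF) :
    extSub (condE hm Q (X : Ω →ₘ[P] ℝ)) (conjugate hm π Q) ≤ toExt (π X : Ω →ₘ[P] ℝ) := by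
  rw [extSub_le_comm, extSub_toExt]
  exact toExt_le_conjugate hm π Q X

theorem K_le_on (hm : mG ≤ mF) (hQP : Q ≪ P) (hint : ∀ ξ ∈ LF, Integrable ξ Q)
    (hstab : ∀ X ∈ LF, ∀ A (hA : MeasurableSet A), X * ind P hA ∈ LF)
    (hreg : IsRegularMap hm π) (X ξ : LF) {A : Set Ω} (hA : MeasurableSet[mG] A)
    (hle : ∀ᵐ ω ∂Q, ω ∈ A → (Q[(X : Ω →ₘ[P] ℝ) | mG]) ω ≤ (Q[(ξ : Ω →ₘ[P] ℝ) | mG]) ω) :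
    ∀ᵐ ω ∂P, ω ∈ A → K mG π X Q ω ≤ ((π ξ : Ω →ₘ[P] ℝ) ω : EReal) := by
  classical
  obtain ⟨ζ, hζ, hπζ⟩ := hreg.exists_piecewise hstab ξ X hA
  have hcond : Q[(X : Ω →ₘ[P] ℝ) | mG] ≤ᵐ[Q] Q[(ζ : Ω →ₘ[P] ℝ) | mG] := by
    filter_upwards [condExp_congr_ae (m := mG) (hQP.ae_eq hζ),
      condExp_piecewise hm (hint ξ ξ.2) (hint X X.2) hA, hle] with ω hcongr hpiece hleω
    rw [hcongr, hpiece]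
    by_cases hω : ω ∈ A
    · simpa only [Set.piecewise_eq_of_mem _ _ _ hω] using hleω hω
    · rw [Set.piecewise_eq_of_notMem _ _ _ hω]
  have hK : K mG π X Q ≤ toExt (π ζ : Ω →ₘ[P] ℝ) := (isGLB_aeInf _).1 ⟨ζ, hcond, rfl⟩
  filter_upwards [AEEqFun.coeFn_le.2 hK, coeFn_toExt (π ζ : Ω →ₘ[P] ℝ), hπζ]
    with ω hKω hext hπ hω
  rwa [hext, hπ, Set.piecewise_eq_of_mem _ _ _ hω] at hKω

theorem K_le_toExt_sub (hm : mG ≤ mF) (hQ : Q ∈ probAgreeing mG P)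
    (hint : ∀ ξ ∈ LF, Integrable ξ Q)
    (hstab : ∀ X ∈ LF, ∀ A (hA : MeasurableSet A), X * ind P hA ∈ LF) (hGF : LG ≤ LF)
    (hone : (1 : Ω →ₘ[P] ℝ) ∈ LG) (hreg : IsRegularMap hm π) (hcas : IsCashAdditive π)
    (X ξ : LF) :
    K mG π X Q ≤ toExt (condE hm Q (X : Ω →ₘ[P] ℝ) -
      (condE hm Q (ξ : Ω →ₘ[P] ℝ) - (π ξ : Ω →ₘ[P] ℝ))) := by
  have := hQ.1
  let d : Ω → ℝ := Q[(X : Ω →ₘ[P] ℝ) | mG] - Q[(ξ : Ω →ₘ[P] ℝ) | mG]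
  let shift (q : ℚ) : LG := ⟨(q : ℝ) • 1, LG.smul_mem _ hone⟩
  have hKq : ∀ q : ℚ, ∀ᵐ ω ∂P, d ω ≤ q →
      K mG π X Q ω ≤ (((π ξ : Ω →ₘ[P] ℝ) ω + q : ℝ) : EReal) := fun q => by
    have hd : MeasurableSet[mG] {ω | d ω ≤ q} :=
      (stronglyMeasurable_condExp.sub stronglyMeasurable_condExp).measurableSet_le
        stronglyMeasurable_const
    have hsum : (↑(ξ + Submodule.inclusion hGF (shift q)) : Ω →ₘ[P] ℝ) =ᵐ[P]
        ⇑(ξ : Ω →ₘ[P] ℝ) + fun _ => (q : ℝ) :=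
      (AEEqFun.coeFn_add _ _).trans ((EventuallyEq.refl _ _).add (coeFn_smul_one _))
    have hcond : ∀ᵐ ω ∂Q, d ω ≤ q → (Q[(X : Ω →ₘ[P] ℝ) | mG]) ω ≤
        (Q[(↑(ξ + Submodule.inclusion hGF (shift q)) : Ω →ₘ[P] ℝ) | mG]) ω := by
      filter_upwards [condExp_congr_ae (m := mG) (hQ.2.1.ae_eq hsum),
        condExp_add (hint ξ ξ.2) (integrable_const (q : ℝ)) mG] with ω hcongr hadd hdq
      rw [hcongr, hadd, Pi.add_apply, condExp_const hm]
      exact sub_le_iff_le_add'.1 hdq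
    filter_upwards [K_le_on hm hQ.2.1 hint hstab hreg X _ hd hcond,
      AEEqFun.coeFn_add (π ξ : Ω →ₘ[P] ℝ) (shift q), coeFn_smul_one (P := P) (q : ℝ)]
      with ω hK hadd hconst hdq
    have hKω := hK hdq
    rwa [hcas.map_add hGF, Submodule.coe_add, hadd, Pi.add_apply, hconst] at hKω
  rw [← AEEqFun.coeFn_le]
  filter_upwards [ae_all_iff.2 hKq, coeFn_toExt (condE hm Q (X : Ω →ₘ[P] ℝ) -
    (condE hm Q (ξ : Ω →ₘ[P] ℝ) - (π ξ : Ω →ₘ[P] ℝ))), AEEqFun.coeFn_sub (condE hm Q _)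
    (condE hm Q _ - (π ξ : Ω →ₘ[P] ℝ)), AEEqFun.coeFn_sub (condE hm Q _) (π ξ : Ω →ₘ[P] ℝ),
    coeFn_condE hm Q (X : Ω →ₘ[P] ℝ), coeFn_condE hm Q (ξ : Ω →ₘ[P] ℝ)]
    with ω hK hext houter hinner hX hξ
  rw [hext, houter, Pi.sub_apply, hinner, Pi.sub_apply, hX, hξ, ← EReal.le_of_forall_lt_iff_le]
  intro z hz
  obtain ⟨q, hdq, hqz⟩ : ∃ q : ℚ, d ω < q ∧ q < z - (π ξ : Ω →ₘ[P] ℝ) ω :=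
    exists_rat_btwn (by
      have := EReal.coe_lt_coe_iff.1 hz
      simp only [d, Pi.sub_apply]
      linarith)
  exact (hK q hdq.le).trans (EReal.coe_le_coe_iff.2 (by linarith))

theorem K_eq_extSub_conjugate (hm : mG ≤ mF) (hQ : Q ∈ probAgreeing mG P)
    (hint : ∀ ξ ∈ LF, Integrable ξ Q)
    (hstab : ∀ X ∈ LF, ∀ A (hA : MeasurableSet A), X * ind P hA ∈ LF) (hGF : LG ≤ LF)
    (hone : (1 : Ω →ₘ[P] ℝ) ∈ LG) (hreg : IsRegularMap hm π) (hcas : IsCashAdditive π)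
    (X : LF) :
    K mG π X Q = extSub (condE hm Q (X : Ω →ₘ[P] ℝ)) (conjugate hm π Q) := by
  refine le_antisymm ?_ ((isGLB_aeInf _).2 ?_)
  · rw [le_extSub_comm, conjugate_le_iff]
    intro ξ
    rw [← le_extSub_comm, extSub_toExt]
    exact K_le_toExt_sub hm hQ hint hstab hGF hone hreg hcas X ξ
  · rintro _ ⟨ξ, hξ, rfl⟩
    rw [extSub_le_comm, extSub_toExt]
    exact (toExt_mono (sub_le_sub_right (condE_le_condE hm hQ hξ) _)).trans
      (toExt_le_conjugate hm π Q ξ)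

end PenaltyFunction

section DualRepresentation

variable {Ω : Type u} {mG mF : MeasurableSpace Ω} {P : Measure Ω}
  {L LF LG : Submodule ℝ (Ω →ₘ[P] ℝ)} {π : LF → LG}

theorem coeFn_smul_ind (c : ℝ) {A : Set Ω} (hA : MeasurableSet A) :
    (c • ind P hA : Ω →ₘ[P] ℝ) =ᵐ[P] A.indicator fun _ => c := by
  filter_upwards [AEEqFun.coeFn_smul c (ind P hA), coeFn_ind (P := P) hA] with ω hsmul hind
  rw [hsmul, Pi.smul_apply, hind]
  by_cases hω : ω ∈ A <;> simp [hω]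

theorem not_smul_ind_nonpos {c : ℝ} (hc : 0 < c) {A : Set Ω} (hA : MeasurableSet A)
    (hpos : P A ≠ 0) : ¬ c • ind P hA ≤ 0 := fun hle => by
  refine hpos (ae_eq_empty.1 ?_)
  filter_upwards [AEEqFun.coeFn_le.2 hle, coeFn_smul_ind (P := P) c hA,
    AEEqFun.coeFn_zero (α := Ω) (β := ℝ) (μ := P)] with ω hleω hω hzero
  refine eq_false fun hωA => hc.not_ge ?_
  rwa [hω, Set.indicator_of_mem hωA, hzero] at hleω

theorem IsPasteStable.exists_measurableSet_forall_condExp_lt [IsFiniteMeasure P] (hm : mG ≤ mF)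
    {𝒜 : Set L} (hpaste : IsPasteStable mG 𝒜) (hne : 𝒜.Nonempty) {g : Ω →ₘ[P] ℝ}
    (hg : g ∈ orderDual L) {x : L} {s : ℝ}
    (h𝒜 : ∀ ξ ∈ 𝒜, ∫ ω, g ω * (ξ : Ω →ₘ[P] ℝ) ω ∂P ≤ s)
    (hx : s < ∫ ω, g ω * (x : Ω →ₘ[P] ℝ) ω ∂P) :
    ∃ C, MeasurableSet[mG] C ∧ P C ≠ 0 ∧ ∀ ξ ∈ 𝒜, ∀ᵐ ω ∂P, ω ∈ C →
      (P[fun ω => g ω * (ξ : Ω →ₘ[P] ℝ) ω | mG]) ω <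
        (P[fun ω => g ω * (x : Ω →ₘ[P] ℝ) ω | mG]) ω := by
  classical
  have hint (ξ : L) : Integrable (fun ω => g ω * (ξ : Ω →ₘ[P] ℝ) ω) P :=
    integrable_mul_of_mem_orderDual hg ξ.2
  let gap (ξ : 𝒜) : Ω → ℝ := P[fun ω => g ω * (ξ : Ω →ₘ[P] ℝ) ω | mG] -
    P[fun ω => g ω * (x : Ω →ₘ[P] ℝ) ω | mG]
  have hgap_paste (ξ η : 𝒜) (A : Set Ω) (hA : MeasurableSet[mG] A) :
      ∃ ζ, gap ζ =ᵐ[P] A.piecewise (gap ξ) (gap η) := by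
    obtain ⟨ζ, hζ𝒜, hζ⟩ := hpaste ξ ξ.2 η η.2 A hA
    refine ⟨⟨ζ, hζ𝒜⟩, ?_⟩
    have hprod : (fun ω => g ω * (ζ : Ω →ₘ[P] ℝ) ω) =ᵐ[P] A.piecewise
        (fun ω => g ω * (ξ : Ω →ₘ[P] ℝ) ω) fun ω => g ω * (η : Ω →ₘ[P] ℝ) ω := by
      filter_upwards [hζ] with ω hω
      rw [hω]
      by_cases hωA : ω ∈ A <;> simp [hωA]
    filter_upwards [condExp_congr_ae (m := mG) hprod, condExp_piecewise hm (hint ξ) (hint η) hA]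
      with ω hcongr hpiece
    simp only [gap, Pi.sub_apply, hcongr, hpiece]
    by_cases hωA : ω ∈ A <;> simp [hωA]
  have hgap_integral (ξ : 𝒜) : ∫ ω, gap ξ ω ∂P ≤ s - ∫ ω, g ω * (x : Ω →ₘ[P] ℝ) ω ∂P := by
    rw [integral_sub' integrable_condExp integrable_condExp, integral_condExp hm,
      integral_condExp hm]
    exact sub_le_sub_right (h𝒜 ξ ξ.2) _
  have := hne.to_subtype
  obtain ⟨C, hC, hCpos, hlt⟩ := exists_measurableSet_forall_ae_neg hm
    (fun ξ => stronglyMeasurable_condExp.sub stronglyMeasurable_condExp)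
    (fun ξ => integrable_condExp.sub integrable_condExp) hgap_paste (sub_neg.2 hx) hgap_integral
  refine ⟨C, hC, hCpos, fun ξ hξ => ?_⟩
  filter_upwards [hlt ⟨ξ, hξ⟩] with ω hω hωC
  exact sub_neg.1 (hω hωC)

theorem exists_mem_dualProb_condE_lt_on [IsProbabilityMeasure P] (hm : mG ≤ mF)
    (hne : (dualProb L ∩ probAgreeing mG P).Nonempty)
    (hind : ∀ A (hA : MeasurableSet A), ind P hA ∈ L) {𝒜 : Set L} (h𝒜_ne : 𝒜.Nonempty)
    (hlower : IsLowerSet 𝒜) (hpaste : IsPasteStable mG 𝒜) (hconv : Convex ℝ 𝒜)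
    (hcl : IsClosed[weakTopology L] 𝒜) {x : L} (hx : x ∉ 𝒜) :
    ∃ Q ∈ dualProb L ∩ probAgreeing mG P, ∃ C, MeasurableSet[mG] C ∧ P C ≠ 0 ∧
      ∀ ξ ∈ 𝒜, ∀ᵐ ω ∂P, ω ∈ C →
        condE hm Q (ξ : Ω →ₘ[P] ℝ) ω < condE hm Q (x : Ω →ₘ[P] ℝ) ω := by
  obtain ⟨g, hg, s, hs, hsx⟩ := exists_separating_density hconv hcl hx
  have hg_nonneg : 0 ≤ᵐ[P] g :=
    ae_nonneg_of_bddAbove_on_lowerSet hg hind hlower h𝒜_ne fun ξ hξ => (hs ξ hξ).le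
  obtain ⟨C, hC, hCpos, hlt⟩ := hpaste.exists_measurableSet_forall_condExp_lt hm h𝒜_ne hg
    (fun ξ hξ => (hs ξ hξ).le) hsx
  have hpos : ∀ᵐ ω ∂P, ω ∈ C → 0 < (P[g | mG]) ω := by
    obtain ⟨ξ, hξ⟩ := h𝒜_ne
    have hnull := ae_condExp_mul_eq_zero_of_condExp_nonpos hm (integrable_of_mem_orderDual hg)
      hg_nonneg
    filter_upwards [hlt ξ hξ, hnull (ξ : Ω →ₘ[P] ℝ), hnull (x : Ω →ₘ[P] ℝ)]
      with ω hltω hξω hxω hω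
    by_contra! hle
    exact (hltω hω).ne ((hξω hle).trans (hxω hle).symm)
  obtain ⟨δ, hδ, hδpos⟩ := exists_pos_measure_inter_setOf_le_ne_zero hCpos hpos
  have hCδ : MeasurableSet[mG] (C ∩ {ω | δ ≤ (P[g | mG]) ω}) :=
    hC.inter (stronglyMeasurable_const.measurableSet_le stronglyMeasurable_condExp)
  obtain ⟨Q, hQ, hQcond⟩ := exists_mem_dualProb_condE_eq_on hm hne hg hg_nonneg hCδ hδ
    fun ω hω => hω.2
  refine ⟨Q, hQ, _, hCδ, hδpos, fun ξ hξ => ?_⟩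
  filter_upwards [hQcond ξ ξ.2, hQcond x x.2, hlt ξ hξ] with ω hξω hxω hltω hω
  rw [hξω hω, hxω hω]
  exact mul_lt_mul_of_pos_left (hltω hω.1) (inv_pos.2 (hδ.trans_le hω.2))

theorem conjugate_le_on_of_forall_mem_acceptanceSet [IsFiniteMeasure P] (hm : mG ≤ mF)
    {Q : Measure Ω} (hQ : Q ∈ probAgreeing mG P) (hint : ∀ ξ ∈ LF, Integrable ξ Q)
    (hmeas : ∀ Y ∈ LG, AEStronglyMeasurable[mG] Y P) (hGF : LG ≤ LF) (hcas : IsCashAdditive π)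
    {W : Ω →ₘ[P] ℝ} {C : Set Ω} (hC : MeasurableSet C)
    (hW : ∀ ξ ∈ acceptanceSet π, ∀ᵐ ω ∂P, ω ∈ C → condE hm Q (ξ : Ω →ₘ[P] ℝ) ω ≤ W ω) :
    ∀ᵐ ω ∂P, ω ∈ C → conjugate hm π Q ω ≤ (W ω : EReal) := by
  have hext : ∀ᵐ ω ∂P, ω ∈ C → conjugate hm π Q ω ≤ toExt W ω := aeSup_le_on hC <| by
    rintro _ ⟨ξ, rfl⟩
    have hsub := condE_sub_of_aestronglyMeasurable hm hQ (hint ξ ξ.2) (hint _ (hGF (π ξ).2))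
      (hmeas _ (π ξ).2)
    filter_upwards [hW _ (hcas.map_sub_self hGF ξ).le, coeFn_toExt W,
      coeFn_toExt (condE hm Q (ξ : Ω →ₘ[P] ℝ) - (π ξ : Ω →ₘ[P] ℝ))] with ω hω hWω hξω hωC
    rw [hWω, hξω, ← hsub]
    exact EReal.coe_le_coe_iff.2 (hω hωC)
  filter_upwards [hext, coeFn_toExt W] with ω hω hWω hωC
  exact hWω ▸ hω hωC

/- Separate `X - π(X) + ε 1_B`, whose value under `π` is `ε 1_B`, from the acceptance set. As
`X - π(X)` is accepted, the separation can only take place inside `B`. -/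
theorem exists_mem_dualProb_conjugate_le_on [IsProbabilityMeasure P] (hm : mG ≤ mF)
    (hne : (dualProb LF ∩ probAgreeing mG P).Nonempty)
    (hstab : ∀ X ∈ LF, ∀ A (hA : MeasurableSet A), X * ind P hA ∈ LF)
    (hmeas : ∀ Y ∈ LG, AEStronglyMeasurable[mG] Y P) (hGF : LG ≤ LF)
    (hone : (1 : Ω →ₘ[P] ℝ) ∈ LG) (hmon : Monotone π) (hreg : IsRegularMap hm π)
    (hcas : IsCashAdditive π) (hconv : Convex ℝ (acceptanceSet π))
    (hcl : IsClosed[weakTopology LF] (acceptanceSet π)) (X : LF) {ε : ℝ} (hε : 0 < ε) {B : Set Ω}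
    (hB : MeasurableSet[mG] B) (hBpos : P B ≠ 0) :
    ∃ Q ∈ dualProb LF ∩ probAgreeing mG P, ∃ C, MeasurableSet[mG] C ∧ C ≤ᵐ[P] B ∧ P C ≠ 0 ∧
      ∀ᵐ ω ∂P, ω ∈ C → conjugate hm π Q ω ≤
        ((condE hm Q (X : Ω →ₘ[P] ℝ) ω - (π X : Ω →ₘ[P] ℝ) ω + ε : ℝ) : EReal) := by
  let bump : LG := ⟨ε • ind P (hm B hB), LG.smul_mem ε (hreg.ind_mem hcas hstab hGF hone hB)⟩
  let x₀ : LF := X - Submodule.inclusion hGF (π X)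
  have hx₀ : π x₀ = 0 := hcas.map_sub_self hGF X
  have hbump : x₀ + Submodule.inclusion hGF bump ∉ acceptanceSet π := fun hmem => by
    refine not_smul_ind_nonpos hε (hm B hB) hBpos ?_
    change π (x₀ + Submodule.inclusion hGF bump) ≤ 0 at hmem
    rwa [hcas.map_add hGF, hx₀, zero_add] at hmem
  have hind : ∀ A (hA : MeasurableSet A), ind P hA ∈ LF := fun A hA =>
    one_mul (ind P hA) ▸ hstab 1 (hGF hone) A hA
  obtain ⟨Q, hQ, C, hC, hCpos, hlt⟩ := exists_mem_dualProb_condE_lt_on hm hne hind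
    ⟨x₀, hx₀.le⟩ (isLowerSet_acceptanceSet hmon) (hreg.isPasteStable_acceptanceSet hstab)
    hconv hcl hbump
  have hint : ∀ ξ ∈ LF, Integrable ξ Q := fun ξ hξ => integrable_of_mem_dualProb hQ.1 hξ
  have hadd := condE_add_of_aestronglyMeasurable hm hQ.2 (hint x₀ x₀.2) (hint _ (hGF bump.2))
    (hmeas _ bump.2)
  have hsub := condE_sub_of_aestronglyMeasurable hm hQ.2 (hint X X.2) (hint _ (hGF (π X).2))
    (hmeas _ (π X).2)
  have hconj := conjugate_le_on_of_forall_mem_acceptanceSet hm hQ.2 hint hmeas hGF hcas (hm C hC)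
    fun ξ hξ => (hlt ξ hξ).mono fun ω hω hωC => (hω hωC).le
  refine ⟨Q, hQ, C, hC, ?_, hCpos, ?_⟩
  · filter_upwards [hlt x₀ hx₀.le, AEEqFun.coeFn_add (condE hm Q (x₀ : Ω →ₘ[P] ℝ)) bump,
      coeFn_smul_ind (P := P) ε (hm B hB)] with ω hltω haddω hω hωC
    by_contra hωB
    have hself := hltω hωC
    rw [Submodule.coe_add, Submodule.coe_inclusion, hadd, haddω, Pi.add_apply, hω,
      Set.indicator_of_notMem hωB, add_zero] at hself
    exact hself.false
  · filter_upwards [hconj, AEEqFun.coeFn_add (condE hm Q (x₀ : Ω →ₘ[P] ℝ)) bump,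
      AEEqFun.coeFn_sub (condE hm Q (X : Ω →ₘ[P] ℝ)) (π X),
      coeFn_smul_ind (P := P) ε (hm B hB)] with ω hconjω haddω hsubω hω hωC
    refine (hconjω hωC).trans (EReal.coe_le_coe_iff.2 ?_)
    rw [Submodule.coe_add, Submodule.coe_inclusion, hadd, haddω, Pi.add_apply, hω,
      AddSubgroupClass.coe_sub, Submodule.coe_inclusion, hsub, hsubω, Pi.sub_apply]
    exact add_le_add_right (Set.indicator_le_self' (fun _ _ => hε.le) ω) _

theorem toExt_le_aeSup_extSub_conjugate [IsProbabilityMeasure P] (hm : mG ≤ mF)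
    (hne : (dualProb LF ∩ probAgreeing mG P).Nonempty)
    (hstab : ∀ X ∈ LF, ∀ A (hA : MeasurableSet A), X * ind P hA ∈ LF)
    (hmeas : ∀ Y ∈ LG, AEStronglyMeasurable[mG] Y P) (hGF : LG ≤ LF)
    (hone : (1 : Ω →ₘ[P] ℝ) ∈ LG) (hmon : Monotone π) (hreg : IsRegularMap hm π)
    (hcas : IsCashAdditive π) (hconv : Convex ℝ (acceptanceSet π))
    (hcl : IsClosed[weakTopology LF] (acceptanceSet π)) (X : LF) :
    toExt (π X : Ω →ₘ[P] ℝ) ≤ aeSup {Z | ∃ Q ∈ dualProb LF ∩ probAgreeing mG P,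
      Z = extSub (condE hm Q (X : Ω →ₘ[P] ℝ)) (conjugate hm π Q)} := by
  set W := aeSup {Z | ∃ Q ∈ dualProb LF ∩ probAgreeing mG P,
    Z = extSub (condE hm Q (X : Ω →ₘ[P] ℝ)) (conjugate hm π Q)}
  have happrox : ∀ n : ℕ, ∀ᵐ ω ∂P,
      (((π X : Ω →ₘ[P] ℝ) ω - 1 / ((n : ℝ) + 1) : ℝ) : EReal) ≤ W ω := fun n => by
    refine ae_of_forall_exists_ae_on hm fun B hB hBpos => ?_
    obtain ⟨Q, hQ, C, hC, hCB, hCpos, hconj⟩ := exists_mem_dualProb_conjugate_le_on hm hne hstab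
      hmeas hGF hone hmon hreg hcas hconv hcl X (ε := 1 / ((n : ℝ) + 1))
      Nat.one_div_pos_of_nat hB hBpos
    refine ⟨C, hC, hCB, hCpos, ?_⟩
    have hQW : extSub (condE hm Q (X : Ω →ₘ[P] ℝ)) (conjugate hm π Q) ≤ W :=
      (isLUB_aeSup _).1 ⟨Q, hQ, rfl⟩
    filter_upwards [hconj, AEEqFun.coeFn_le.2 hQW, coeFn_extSub (condE hm Q (X : Ω →ₘ[P] ℝ))
      (conjugate hm π Q)] with ω hconjω hleW hext hωC
    refine le_trans ?_ (hext.symm.le.trans hleW)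
    refine le_trans (EReal.coe_le_coe_iff.2 ?_) ((EReal.coe_sub _ _).le.trans
      (EReal.sub_le_sub le_rfl (hconjω hωC)))
    linarith
  rw [← AEEqFun.coeFn_le]
  filter_upwards [ae_all_iff.2 happrox, coeFn_toExt (π X : Ω →ₘ[P] ℝ)] with ω hω hext
  rw [hext, ← EReal.ge_of_forall_gt_iff_ge]
  intro z hz
  obtain ⟨n, hn⟩ := exists_nat_one_div_lt (sub_pos.2 (EReal.coe_lt_coe_iff.1 hz))
  exact (EReal.coe_le_coe_iff.2 (by linarith)).trans (hω n)

end DualRepresentation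

end CondQuasiconvex

open CondQuasiconvex in
theorem mainTheorem3_general {Ω : Type u} {mG mF : MeasurableSpace Ω} (hm : mG ≤ mF)
    (P : Measure Ω) [IsProbabilityMeasure P] (LF LG : Submodule ℝ (Ω →ₘ[P] ℝ))
    (hstab : ∀ X ∈ LF, ∀ A (hA : MeasurableSet A), X * ind P hA ∈ LF)
    (hmeas : ∀ Y ∈ LG, AEStronglyMeasurable[mG] Y P) (hGF : LG ≤ LF)
    (hone : (1 : Ω →ₘ[P] ℝ) ∈ LG) (π : LF → LG) (hreg : IsRegularMap hm π)
    (hcas : IsCashAdditive π) :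
    (∀ Q ∈ probAgreeing mG P, (∀ ξ ∈ LF, Integrable ξ Q) → ∀ X : LF,
      K mG π X Q = extSub (condE hm Q (X : Ω →ₘ[P] ℝ)) (conjugate hm π Q)) ∧
    (Monotone π → Convex ℝ (acceptanceSet π) → IsClosed[weakTopology LF] (acceptanceSet π) →
      (dualProb LF ∩ probAgreeing mG P).Nonempty → ∀ X : LF, toExt (π X : Ω →ₘ[P] ℝ) =
        aeSup {Z | ∃ Q ∈ dualProb LF ∩ probAgreeing mG P,
          Z = extSub (condE hm Q (X : Ω →ₘ[P] ℝ)) (conjugate hm π Q)}) := by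
  refine ⟨fun Q hQ hint => K_eq_extSub_conjugate hm hQ hint hstab hGF hone hreg hcas,
    fun hmon hconv hcl hne X => le_antisymm ?_ ((isLUB_aeSup _).2 ?_)⟩
  · exact toExt_le_aeSup_extSub_conjugate hm hne hstab hmeas hGF hone hmon hreg hcas hconv hcl X
  · rintro _ ⟨Q, -, rfl⟩
    exact extSub_conjugate_le_toExt hm π Q X

open CondQuasiconvex in
theorem mainTheorem3 {Ω : Type u} {mG mF : MeasurableSpace Ω} (hm : mG ≤ mF)
    (P : Measure Ω) [IsProbabilityMeasure P]
    (LF LG : Submodule ℝ (Ω →ₘ[P] ℝ)) (hL : Admissible hm LF LG)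
    (hGF : LG ≤ LF) (hone : (1 : Ω →ₘ[P] ℝ) ∈ LG)
    (hE : ∀ Q ∈ dualProb LF ∩ probAgreeing mG P, ∀ ξ ∈ LF, condE hm Q ξ ∈ LF)
    (π : LF → LG) (hmon : Monotone π) (hreg : IsRegularMap hm π) (hcas : IsCashAdditive π) :
    (∀ Q ∈ dualProb LF ∩ probAgreeing mG P, ∀ X : LF,
      K mG π X Q = extSub (condE hm Q (X : Ω →ₘ[P] ℝ)) (conjugate hm π Q)) ∧
    (IsQuasiconvex mG π → IsWeakLSC π → (dualProb LF ∩ probAgreeing mG P).Nonempty →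
      ∀ X : LF, toExt (π X : Ω →ₘ[P] ℝ) =
        aeSup {Z | ∃ Q ∈ dualProb LF ∩ probAgreeing mG P,
          Z = extSub (condE hm Q (X : Ω →ₘ[P] ℝ)) (conjugate hm π Q)}) := by
  obtain ⟨hK, hrepr⟩ := mainTheorem3_general hm P LF LG hL.ind_memF hL.measurableG hGF hone π hreg
    hcas
  exact ⟨fun Q hQ => hK Q hQ.2 fun _ => integrable_of_mem_dualProb hQ.1,
    fun hqco hlsc => hrepr hmon hqco.convex_acceptanceSet (hlsc 0)⟩
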